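/- Let $n\ge 2$, let $\lambda$ be an irreducible (real or complex) orthogonal representation of $\mathfrak{so}(n)$ on a finite-dimensional Euclidean space $V$ (for instance the differential of an irreducible representation of $\mathrm{SO}(n)$ or $\mathrm{Spin}(n)$), with highest weight $\lambda=(\lambda_1,\dots,\lambda_{\lfloor n/2\rfloor})$. Let $B(\alpha\otimes v)=\sum_{i=1}^n e_i\otimes d\lambda(e_i\wedge\alpha)v$ on $\mathbb R^n\otimes V$, where $a\wedge b\in\mathfrak{so}(n)$ is $x\mapsto\langle a,x\rangle b-\langle b,x\rangle a$; let $w_1>\dots>w_N$ be its distinct eigenvalues (the conformal weights) and $\Pi_j$ the orthogonal projection onto the $w_j$-eigenspace. Let $(M,g)$ be a Riemannian manifold of dimension $n$, $E\to M$ a Euclidean vector bundle associated to $\lambda$ (through the bundle of oriented orthonormal frames, or through a spin structure), and $\nabla$ any metric connection on $E$. Denote by $\Pi_j$ also the induced projection of $T^*M\otimes E$, put $P_j=\Pi_j\circ\nabla$, and let $|\nabla\xi|$ be the tensor (Hilbert--Schmidt) norm. Then $N=2$ if and only if either $n$ is even and $\lambda=(k,\dots,k,\pm k)$ with $k>0$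 (so that $V=\odot^{2k}\Delta_\pm$ is a Cartan power of a half-spin representation), or $n$ is odd and $\lambda=(\tfrac12,\dots,\tfrac12)$ (the spin representation; put $k=\tfrac12$). Suppose $N=2$. Then $w_1=k$, $w_2=1-\tfrac n2-k$, and: (i) If $\xi$ is a section of $E$ with $P_1\xi=0$ ($P_1$ is the twistor operator), then at every point where $\xi\ne0$, $$\bigl|d|\xi|\bigr|\le\sqrt{\frac{w_1}{w_1-w_2}}\,|\nabla\xi|=\sqrt{\frac{k}{2k+\frac n2-1}}\,|\nabla\xi|,$$ with equality at such a point if and only if $\nabla\xi=\Pi_2(\alpha\otimes\xi)$ there for some $1$-form $\alpha$ at that point. (ii) If $\xi$ is a section of $E$ with $P_2\xi=0$, then at every point where $\xi\ne0$, $$\bigl|d|\xi|\bigr|\le\sqrt{\frac{-w_2}{w_1-w_2}}\,|\nabla\xi|=\sqrt{\frac{k+\frac n2-1}{2k+\frac n2-1}}\,|\nabla\xi|,$$ with equality at such a point if and only if $\nabla\xi=\Pi_1(\alpha\otimes\xi)$ there for some $1$-form $\alpha$ at that point. -/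

import Mathlib

open scoped TensorProduct Manifold ContDiff Bundle InnerProductSpace
open Bundle

attribute [local instance 100] LieRing.ofAssociativeRing

noncomputable section

namespace Kato

/-- The Lie algebra `𝔰𝔬(n)` of skew-symmetric real `n × n` matrices. -/
abbrev soAlg (n : ℕ) : LieSubalgebra ℝ (Matrix (Fin n) (Fin n) ℝ) :=
  LieAlgebra.Orthogonal.so (Fin n) ℝ

/-- Euclidean space `ℝⁿ`. -/
abbrev Rn (n : ℕ) : Type := EuclideanSpace ℝ (Fin n)

/-- The standard orthonormal basis `e₁, …, eₙ` of `ℝⁿ`. -/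
abbrev e {n : ℕ} (i : Fin n) : Rn n := EuclideanSpace.single i 1

/-- The element `a ∧ b` of `𝔰𝔬(n)`, acting on `ℝⁿ` by `x ↦ ⟨a, x⟩ b - ⟨b, x⟩ a`. -/
def wedge {n : ℕ} (a b : Rn n) : soAlg n :=
  ⟨Matrix.of fun i j => b i * a j - a i * b j, by
    rw [LieAlgebra.Orthogonal.mem_so]
    ext i j
    simp only [Matrix.transpose_apply, Matrix.of_apply, Matrix.neg_apply]
    ring⟩

theorem wedge_mulVec {n : ℕ} (a b x : Rn n) :
    (wedge a b : Matrix (Fin n) (Fin n) ℝ).mulVec x =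
      (inner ℝ a x • b - inner ℝ b x • a : Rn n) := by
  ext i
  simp only [wedge, Matrix.mulVec, dotProduct, Matrix.of_apply, sub_mul, Finset.sum_sub_distrib,
    PiLp.sub_apply, PiLp.smul_apply, PiLp.inner_apply, smul_eq_mul, Finset.sum_mul]
  congr 1 <;> refine Finset.sum_congr rfl fun j _ => ?_ <;> simp <;> ring

theorem wedge_add {n : ℕ} (a b c : Rn n) : wedge a (b + c) = wedge a b + wedge a c := by
  ext i j
  simp [wedge]
  ring

theorem wedge_smul {n : ℕ} (r : ℝ) (a b : Rn n) : wedge a (r • b) = r • wedge a b := by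
  ext i j
  simp [wedge]
  ring

/-! ### Representations of `𝔰𝔬(n)` by skew endomorphisms -/

/-- A representation `dλ` of `𝔰𝔬(n)` on the Euclidean space `V` by skew endomorphisms, i.e. the
differential of an orthogonal representation `λ`. -/
structure OrthRep (n : ℕ) (V : Type*) [NormedAddCommGroup V] [InnerProductSpace ℝ V] where
  act : soAlg n →ₗ⁅ℝ⁆ Module.End ℝ V
  skew : ∀ (A : soAlg n) (v w : V), inner ℝ (act A v) w = -inner ℝ v (act A w)

namespace OrthRep

variable {n : ℕ} {V : Type*} [NormedAddCommGroup V] [InnerProductSpace ℝ V]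

/-- `V` is irreducible over `ℝ`. -/
def IsRealIrreducible (ρ : OrthRep n V) : Prop :=
  Nontrivial V ∧
    ∀ W : Submodule ℝ V, (∀ A, ∀ w ∈ W, ρ.act A w ∈ W) → W = ⊥ ∨ W = ⊤

/-- `V` is (the underlying Euclidean space of) an irreducible complex representation, for some
invariant orthogonal complex structure `J`. -/
def IsComplexIrreducible (ρ : OrthRep n V) : Prop :=
  Nontrivial V ∧ ∃ J : V ≃ₗᵢ[ℝ] V, (∀ v, J (J v) = -v) ∧ (∀ A v, J (ρ.act A v) = ρ.act A (J v)) ∧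
    ∀ W : Submodule ℝ V, (∀ A, ∀ w ∈ W, ρ.act A w ∈ W) → (∀ w ∈ W, J w ∈ W) → W = ⊥ ∨ W = ⊤

/-- `V` is an irreducible representation, real or complex. -/
def IsIrreducible (ρ : OrthRep n V) : Prop :=
  ρ.IsRealIrreducible ∨ ρ.IsComplexIrreducible

/-! #### Highest weights -/

/-- The endomorphism of `V ⊗ ℂ` by which `a ∧ b ∈ 𝔰𝔬(n, ℂ)` acts, for `a, b ∈ ℂⁿ`. -/
def complexAct (ρ : OrthRep n V) (a b : Fin n → ℂ) : Module.End ℂ (ℂ ⊗[ℝ] V) :=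
  ∑ p, ∑ q, (a p * b q) • (ρ.act (wedge (e p) (e q))).baseChange ℂ

/-- The vector `e_{2j-1} - s i e_{2j}` of `ℂⁿ` (for `j = 1, …, m`; in the code `j` starts at `0`),
which has weight `s ε_j` for `s = ±1`. -/
def weightVec (n : ℕ) (j : Fin (n / 2)) (s : ℝ) : Fin n → ℂ := fun p =>
  if (p : ℕ) = 2 * j then 1 else if (p : ℕ) = 2 * j + 1 then -(s * Complex.I) else 0

/-- `lam = (λ₁, …, λₘ)`, `m = ⌊n/2⌋`, is a highest weight of the representation: some nonzero
`v ∈ V ⊗ ℂ` satisfies `E_j v = i λ_j v` for `E_j = e_{2j-1} ∧ e_{2j}`, and is annihilated by the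
root vectors of the positive roots `ε_i ± ε_j` (`i < j`) and, for odd `n`, `ε_i`. -/
def IsHighestWeight (ρ : OrthRep n V) (lam : Fin (n / 2) → ℝ) : Prop :=
  ∃ v : ℂ ⊗[ℝ] V, v ≠ 0 ∧
    (∀ j : Fin (n / 2),
      (ρ.act (wedge (e ⟨2 * j, by omega⟩) (e ⟨2 * j + 1, by omega⟩))).baseChange ℂ v
        = (Complex.I * (lam j : ℂ)) • v) ∧
    (∀ i j : Fin (n / 2), i < j → ∀ s : ℝ, s = 1 ∨ s = -1 →
      ρ.complexAct (weightVec n i 1) (weightVec n j s) v = 0) ∧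
    (Odd n → ∀ i : Fin (n / 2),
      ρ.complexAct (weightVec n i 1) (fun p => if (p : ℕ) + 1 = n then 1 else 0) v = 0)

/-! #### Conformal weights -/

/-- The operator `B (α ⊗ v) = ∑ᵢ eᵢ ⊗ dλ(eᵢ ∧ α) v` on `ℝⁿ ⊗ V`. -/
def B (ρ : OrthRep n V) : Module.End ℝ (Rn n ⊗[ℝ] V) :=
  TensorProduct.lift <| LinearMap.mk₂ ℝ
    (fun (α : Rn n) (v : V) => ∑ i, e i ⊗ₜ[ℝ] ρ.act (wedge (e i) α) v)
    (by intro α β v; simp [wedge_add, TensorProduct.tmul_add, Finset.sum_add_distrib])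
    (by intro r α v; simp [wedge_smul, Finset.smul_sum])
    (by intro α v w; simp [TensorProduct.tmul_add, Finset.sum_add_distrib])
    (by intro r α v; simp [Finset.smul_sum])

theorem B_tmul (ρ : OrthRep n V) (α : Rn n) (v : V) :
    ρ.B (α ⊗ₜ v) = ∑ i, e i ⊗ₜ[ℝ] ρ.act (wedge (e i) α) v := by
  simp [B]

variable [FiniteDimensional ℝ V]

/-- The finite set of conformal weights: the eigenvalues of `B`. -/
def confWeights (ρ : OrthRep n V) : Finset ℝ :=
  (Module.End.finite_hasEigenvalue ρ.B).toFinset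

/-- The number `N` of (distinct) conformal weights. -/
def numWeights (ρ : OrthRep n V) : ℕ := ρ.confWeights.card

/-- The conformal weights `w₁ > w₂ > … > w_N` in decreasing order, numbered from `1`. -/
def w (ρ : OrthRep n V) (j : ℕ) : ℝ := (ρ.confWeights.sort (· ≥ ·)).getD (j - 1) 0

/-- The orthogonal projection `Π_j` of `ℝⁿ ⊗ V` onto the eigenspace `W_j` of `B` belonging to the
conformal weight `w_j`. -/
def proj (ρ : OrthRep n V) (j : ℕ) : Rn n ⊗[ℝ] V →L[ℝ] Rn n ⊗[ℝ] V :=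
  (Module.End.eigenspace ρ.B (ρ.w j)).starProjection

/-- The group of all pairs `(Ad g, λ(g))`, `g ∈ Spin(n)`, as a group of isometries of `ℝⁿ` and
of `V`; it is generated by the pairs `(exp A, exp dλ(A))` with `A ∈ 𝔰𝔬(n)`. -/
def structureGroup (ρ : OrthRep n V) : Subgroup ((Rn n ≃ₗᵢ[ℝ] Rn n) × (V ≃ₗᵢ[ℝ] V)) :=
  Subgroup.closure {p | ∃ A : soAlg n,
    (∀ x : Rn n, p.1 x = WithLp.toLp 2
      ((NormedSpace.exp (A : Matrix (Fin n) (Fin n) ℝ)).mulVec x)) ∧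
    (∀ v : V, p.2 v = NormedSpace.exp (LinearMap.toContinuousLinearMap (ρ.act A)) v)}

end OrthRep

/-! ### Highest weights of the representations with two conformal weights -/

/-- `n = 2m` is even and `lam = (k, …, k, ±k)` with `k > 0`: the highest weight of the Cartan power
`⊙^{2k} Δ_±` of a half-spin representation. -/
def IsHalfSpinPowerWeight (n : ℕ) (lam : Fin (n / 2) → ℝ) (k : ℝ) : Prop :=
  Even n ∧ 0 < k ∧ ∀ i : Fin (n / 2),
    ((i : ℕ) + 1 < n / 2 → lam i = k) ∧ ((i : ℕ) + 1 = n / 2 → lam i = k ∨ lam i = -k)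

/-- `n` is odd and `lam = (1/2, …, 1/2)`: the highest weight of the spin representation `Δ`;
here `k = 1/2`. -/
def IsSpinWeight (n : ℕ) (lam : Fin (n / 2) → ℝ) (k : ℝ) : Prop :=
  Odd n ∧ k = 1 / 2 ∧ ∀ i, lam i = k

/-! ### Associated bundles and generalized gradients -/

section Bundle

variable {n : ℕ} {V : Type*} [NormedAddCommGroup V] [InnerProductSpace ℝ V]
  [FiniteDimensional ℝ V]
  (M : Type*) [TopologicalSpace M] [ChartedSpace (Rn n) M] [IsManifold (𝓡 n) ∞ M]
  [RiemannianBundle (fun x : M => TangentSpace (𝓡 n) x)]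
  (E : M → Type*) [TopologicalSpace (TotalSpace V E)]
  [∀ x, NormedAddCommGroup (E x)] [∀ x, InnerProductSpace ℝ (E x)]
  [FiberBundle V E]

/-- A structure on the Euclidean vector bundle `E` over the Riemannian manifold `M` of a bundle
associated to the representation `ρ`: around each point `p` of `M` there are a local orthonormal
frame of `TM` and a local isometric trivialization of `E` with fibre `V`, and any two of these
pairs differ by an element `(Ad g, λ(g))` of the structure group. (In other words, `TM` and `E` are
both associated to one principal bundle: the bundle of oriented orthonormal frames
if `λ` is a representation of `SO(n)`, and a spin structure if it is one of `Spin(n)` only.)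
The values of `frame p` and `triv p` outside `baseSet p` are irrelevant. -/
structure AssociatedBundle (ρ : OrthRep n V) where
  baseSet : M → Set M
  isOpen_baseSet : ∀ p, IsOpen (baseSet p)
  mem_baseSet : ∀ p, p ∈ baseSet p
  frame : M → ∀ x : M, Rn n ≃ₗᵢ[ℝ] TangentSpace (𝓡 n) x
  triv : M → ∀ x : M, V ≃ₗᵢ[ℝ] E x
  smooth_frame : ∀ (p : M) (a : Rn n),
    ContMDiffOn (𝓡 n) (𝓡 n).tangent ∞
      (fun x => (⟨x, frame p x a⟩ : TangentBundle (𝓡 n) M)) (baseSet p)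
  smooth_triv : ∀ (p : M) (v : V),
    ContMDiffOn (𝓡 n) ((𝓡 n).prod 𝓘(ℝ, V)) ∞
      (fun x => (⟨x, triv p x v⟩ : TotalSpace V E)) (baseSet p)
  compat : ∀ (p q x : M), x ∈ baseSet p → x ∈ baseSet q →
    ((frame q x).trans (frame p x).symm, (triv q x).trans (triv p x).symm) ∈ ρ.structureGroup

variable {M E}

/-- The pointwise norm `|Φ|` of `Φ ∈ T*ₓM ⊗ Eₓ = Hom(TₓM, Eₓ)`. -/
def tensorNorm {x : M} (Φ : TangentSpace (𝓡 n) x →L[ℝ] E x) : ℝ :=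
  haveI : FiniteDimensional ℝ (TangentSpace (𝓡 n) x) :=
    inferInstanceAs (FiniteDimensional ℝ (Rn n))
  √(∑ i, ‖Φ (stdOrthonormalBasis ℝ (TangentSpace (𝓡 n) x) i)‖ ^ 2)

namespace AssociatedBundle

variable {ρ : OrthRep n V} (S : AssociatedBundle M E ρ)

/-- The identification of `ℝⁿ ⊗ V` with `T*ₓM ⊗ Eₓ = Hom(TₓM, Eₓ)` given by the frame of `TₓM` and
the trivialization of `Eₓ`. -/
def fibreEquiv (x : M) : (Rn n ⊗[ℝ] V) ≃ₗ[ℝ] (TangentSpace (𝓡 n) x →L[ℝ] E x) :=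
  haveI : FiniteDimensional ℝ (TangentSpace (𝓡 n) x) :=
    inferInstanceAs (FiniteDimensional ℝ (Rn n))
  (TensorProduct.congr ((InnerProductSpace.toDual ℝ (Rn n)).toLinearEquiv ≪≫ₗ
      LinearMap.toContinuousLinearMap.symm) (LinearEquiv.refl ℝ V)) ≪≫ₗ
    dualTensorHomEquiv ℝ (Rn n) V ≪≫ₗ
    LinearEquiv.arrowCongr (S.frame x x).toLinearEquiv (S.triv x x).toLinearEquiv ≪≫ₗ
    LinearMap.toContinuousLinearMap

theorem fibreEquiv_tmul (x : M) (α : Rn n) (v : V) (X : TangentSpace (𝓡 n) x) :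
    S.fibreEquiv x (α ⊗ₜ v) X = inner ℝ α ((S.frame x x).symm X) • S.triv x x v := by
  simp [fibreEquiv]

/-- The projection `Π_j` on the fibre `T*ₓM ⊗ Eₓ`. -/
def proj (j : ℕ) (x : M) (Φ : TangentSpace (𝓡 n) x →L[ℝ] E x) : TangentSpace (𝓡 n) x →L[ℝ] E x :=
  S.fibreEquiv x (ρ.proj j ((S.fibreEquiv x).symm Φ))

/-- The generalized gradient `P_j = Π_j ∘ ∇`. -/
def genGrad (cov : CovariantDerivative (𝓡 n) V E) (j : ℕ) (ξ : ∀ x, E x) (x : M) :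
    TangentSpace (𝓡 n) x →L[ℝ] E x :=
  S.proj j x (cov ξ x)

end AssociatedBundle

end Bundle

end Kato

end

namespace Kato

open Matrix

/-! ### The Lie algebra `𝔰𝔬(n)` -/

/-! The operators `ρ.act (wedge (e i) (e j))` are the matrix entries of `B`, so `quad s p i j` are
those of `B² - s B + p`. Since `B` is symmetric, having two conformal weights makes such a quadratic
relation hold, with `s` their sum and `p` their product. The commutators of `𝔰𝔬(n)` give the
antisymmetric part of `B²` as `(1 - n/2) B`, hence `s = 1 - n/2`; the diagonal entries, being sums
of squares, give `p < 0`, hence `w₁ > 0 > w₂`.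

Necessity: write `R` for `cact` and `u_j^s` for `weightVec n j s`. On a highest weight vector of `V
⊗ ℂ` the entry at `(u_i^-, u_i^+)` is a quadratic equation for `λ_i`. Once `λ_l = w₁` for `l < i`,
its roots are `w₁` and `w₂ + i` (`i` from `0`). The second is negative, which dominance excludes
except at the last place of an even `n`, where it equals `-w₁`. For odd `n` the entry of the zero
weight forces `w₁ = 1/2`.

Sufficiency: for the listed weights a highest weight vector is pure: it is killed by the nilradical
of the parabolic of a maximal isotropic subspace and spans a line under the Levi factor. The
relation can then be checked on it, entry by entry in an isotropic basis. The common kernel of the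
entries is invariant, so irreducibility makes it all of `V`. Both roots occur as eigenvalues because
`⟨B(α ⊗ v), α ⊗ v⟩ = 0`.

Kato inequality: with two weights each `Π_j` is an affine function of `B`, and `⟨B(α ⊗ v), β ⊗ v⟩ =
0` by skewness. So `α ↦ Π_j(α ⊗ v)` is a homothety with an explicit factor, and completing a square
(`pointwise_kato`) yields both the sharp constant and the equality case. -/

theorem wedge_eq_vecMulVec {n : ℕ} (a b : Rn n) :
    (wedge a b : Matrix (Fin n) (Fin n) ℝ) = vecMulVec b a - vecMulVec a b := by
  ext i j
  simp [wedge, vecMulVec_apply]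

theorem wedge_swap {n : ℕ} (a b : Rn n) : wedge a b = -wedge b a := by
  ext i j
  simp [wedge]

/-- Skewness of `A` turns `x ᵥ* A` into `-(A *ᵥ x)`, so the two halves of the matrix commutator
combine into a derivation. -/
theorem lie_wedge {n : ℕ} (A : soAlg n) (a b : Rn n) :
    ⁅A, wedge a b⁆ =
      wedge (WithLp.toLp 2 ((A : Matrix (Fin n) (Fin n) ℝ) *ᵥ a)) b +
        wedge a (WithLp.toLp 2 ((A : Matrix (Fin n) (Fin n) ℝ) *ᵥ b)) := by
  have hA : (A : Matrix (Fin n) (Fin n) ℝ)ᵀ = -A := (LieAlgebra.Orthogonal.mem_so _ _ _).1 A.2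
  have hv : ∀ x : Fin n → ℝ, x ᵥ* (A : Matrix (Fin n) (Fin n) ℝ) = -((A : Matrix _ _ ℝ) *ᵥ x) := by
    intro x
    rw [← mulVec_transpose, hA, neg_mulVec]
  apply Subtype.ext
  simp only [LieSubalgebra.coe_bracket, AddMemClass.coe_add, wedge_eq_vecMulVec, Ring.lie_def,
    mul_sub, sub_mul, mul_vecMulVec, vecMulVec_mul, hv]
  ext i j
  simp [vecMulVec_apply]
  ring

theorem lie_wedge_e {n : ℕ} (A : soAlg n) (i j : Fin n) :
    ⁅A, wedge (e i) (e j)⁆ =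
      ∑ l, ((A : Matrix (Fin n) (Fin n) ℝ) l i • wedge (e l) (e j) +
        (A : Matrix (Fin n) (Fin n) ℝ) l j • wedge (e i) (e l)) := by
  have h : ∀ i : Fin n, (WithLp.toLp 2 ((A : Matrix (Fin n) (Fin n) ℝ) *ᵥ (e i : Rn n)) : Rn n) =
      ∑ l, (A : Matrix (Fin n) (Fin n) ℝ) l i • e l := by
    intro i
    ext p
    simp [e, Finset.sum_apply, Pi.single_apply]
  have h1 : ∀ (c : Fin n → ℝ) (b : Rn n), wedge b (∑ l, c l • e l) = ∑ l, c l • wedge b (e l) := by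
    intro c b
    have := map_sum (IsLinearMap.mk' (wedge b) ⟨wedge_add b, fun r a => wedge_smul r b a⟩)
      (fun l => c l • (e l : Rn n)) Finset.univ
    simp only [map_smul, IsLinearMap.mk'_apply] at this
    exact this
  rw [lie_wedge, h, h, h1, wedge_swap (∑ l, _) (e j), h1, Finset.sum_add_distrib, ← Finset.sum_neg_distrib]
  congr 1
  refine Finset.sum_congr rfl fun l _ => ?_
  rw [wedge_swap (e l) (e j), smul_neg]

theorem wedge_e_apply {n : ℕ} (p q i j : Fin n) :
    (wedge (e p) (e q) : Matrix (Fin n) (Fin n) ℝ) i j =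
      (if i = q then 1 else 0) * (if j = p then 1 else 0) -
        (if i = p then 1 else 0) * (if j = q then 1 else 0) := by
  simp [wedge, e]

theorem lie_wedge_e_e {n : ℕ} (p q r s : Fin n) :
    ⁅wedge (e p : Rn n) (e q), wedge (e r) (e s)⁆ =
      (if r = p then (1 : ℝ) else 0) • wedge (e q) (e s)
        - (if r = q then (1 : ℝ) else 0) • wedge (e p) (e s)
        + (if s = p then (1 : ℝ) else 0) • wedge (e r) (e q)
        - (if s = q then (1 : ℝ) else 0) • wedge (e r) (e p) := by
  rw [lie_wedge_e]
  simp only [wedge_e_apply, sub_smul, mul_smul, Finset.sum_add_distrib, Finset.sum_sub_distrib,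
    ite_smul, one_smul, zero_smul, Finset.sum_ite_eq', Finset.mem_univ, if_true]
  abel

/-! ### Complexification of a real vector space -/

section Complexification

variable {V : Type*} [NormedAddCommGroup V] [InnerProductSpace ℝ V]

/-- The inner product on `ℂ ⊗ V` is the real one, the real part of the Hermitian form. This
adjunction stands in for sesquilinearity below. -/
theorem inner_complex_smul_left (z : ℂ) (x y : ℂ ⊗[ℝ] V) :
    inner ℝ (z • x) y = inner ℝ x (star z • y) := by
  induction x with
  | zero => simp
  | add x x' hx hx' => rw [smul_add, inner_add_left, inner_add_left, hx, hx']
  | tmul a v =>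
    induction y with
    | zero => simp
    | add y y' hy hy' => rw [smul_add, inner_add_right, inner_add_right, hy, hy']
    | tmul b w =>
      rw [TensorProduct.smul_tmul', TensorProduct.smul_tmul', TensorProduct.inner_tmul,
        TensorProduct.inner_tmul]
      congr 1
      simp [Complex.inner]
      ring

theorem inner_ofReal_smul_right (c : ℝ) (x y : ℂ ⊗[ℝ] V) :
    inner ℝ x ((c : ℂ) • y) = c * inner ℝ x y := by
  induction x with
  | zero => simp
  | add x x' hx hx' => rw [inner_add_left, inner_add_left, hx, hx', mul_add]
  | tmul a v =>
    induction y with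
    | zero => simp
    | add y y' hy hy' => rw [smul_add, inner_add_right, inner_add_right, hy, hy', mul_add]
    | tmul b w =>
      rw [TensorProduct.smul_tmul', TensorProduct.inner_tmul, TensorProduct.inner_tmul]
      simp [Complex.inner]
      ring

theorem inner_baseChange_of_skew {A : Module.End ℝ V}
    (hA : ∀ v w, inner ℝ (A v) w = -inner ℝ v (A w)) (x y : ℂ ⊗[ℝ] V) :
    inner ℝ (A.baseChange ℂ x) y = -inner ℝ x (A.baseChange ℂ y) := by
  induction x with
  | zero => simp
  | add x x' hx hx' => rw [map_add, inner_add_left, inner_add_left, hx, hx', neg_add]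
  | tmul a v =>
    induction y with
    | zero => simp
    | add y y' hy hy' => rw [map_add, inner_add_right, inner_add_right, hy, hy', neg_add]
    | tmul b w => simp [hA]

/-- The real part `ℂ ⊗ V → V`. -/
noncomputable def rePart (V : Type*) [NormedAddCommGroup V] [InnerProductSpace ℝ V] :
    ℂ ⊗[ℝ] V →ₗ[ℝ] V :=
  TensorProduct.lift ((LinearMap.lsmul ℝ V) ∘ₗ Complex.reLm)

@[simp]
theorem rePart_tmul (z : ℂ) (v : V) : rePart V (z ⊗ₜ v) = z.re • v := by
  simp [rePart]

theorem rePart_baseChange (A : Module.End ℝ V) (x : ℂ ⊗[ℝ] V) :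
    rePart V (A.baseChange ℂ x) = A (rePart V x) := by
  induction x with
  | zero => simp
  | add x x' hx hx' => simp [hx, hx']
  | tmul a v => simp

/-- The minus sign appears because the real part of `i x` is minus the imaginary part of `x`. -/
theorem eq_rePart_add_imPart (x : ℂ ⊗[ℝ] V) :
    x = (1 : ℂ) ⊗ₜ rePart V x - Complex.I • ((1 : ℂ) ⊗ₜ[ℝ] rePart V (Complex.I • x)) := by
  induction x with
  | zero => simp
  | add x x' hx hx' =>
    simp only [smul_add, map_add, TensorProduct.tmul_add]
    nth_rewrite 1 [hx, hx']
    abel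
  | tmul a v =>
    simp only [TensorProduct.smul_tmul', rePart_tmul, smul_eq_mul, ← TensorProduct.smul_tmul,
      ← TensorProduct.sub_tmul]
    congr 1
    apply Complex.ext <;> simp

/-- Real operators commute with taking real and imaginary parts, one of which is nonzero. This
carries the quadratic relation from a complex highest weight vector back to `V`. -/
theorem exists_ne_zero_of_baseChange {ι : Type*} (A : ι → Module.End ℝ V) {x : ℂ ⊗[ℝ] V}
    (hx : x ≠ 0) (h : ∀ i, (A i).baseChange ℂ x = 0) : ∃ v : V, v ≠ 0 ∧ ∀ i, A i v = 0 := by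
  by_cases h0 : rePart V x = 0
  · refine ⟨rePart V (Complex.I • x), ?_, fun i => ?_⟩
    · intro h1
      apply hx
      rw [eq_rePart_add_imPart x, h0, h1]
      simp
    · rw [← rePart_baseChange, map_smul, h, smul_zero, map_zero]
  · exact ⟨_, h0, fun i => by rw [← rePart_baseChange, h, map_zero]⟩

end Complexification

/-! ### The complexified action of `𝔰𝔬(n)` -/

namespace OrthRep

variable {n : ℕ} {V : Type*} [NormedAddCommGroup V] [InnerProductSpace ℝ V] (ρ : OrthRep n V)

/-- The operator `complexAct` as a bilinear map. -/
noncomputable def cact : (Fin n → ℂ) →ₗ[ℂ] (Fin n → ℂ) →ₗ[ℂ] Module.End ℂ (ℂ ⊗[ℝ] V) :=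
  LinearMap.mk₂ ℂ ρ.complexAct
    (by intro a a' b; simp [complexAct, add_mul, add_smul, Finset.sum_add_distrib])
    (by intro c a b; simp [complexAct, mul_assoc, mul_smul, Finset.smul_sum])
    (by intro a b b'; simp [complexAct, mul_add, add_smul, Finset.sum_add_distrib])
    (by intro c a b; simp [complexAct, mul_left_comm, mul_smul, Finset.smul_sum])

theorem cact_apply (a b : Fin n → ℂ) : ρ.cact a b = ρ.complexAct a b := rfl

theorem cact_single (p q : Fin n) :
    ρ.cact (Pi.single p 1) (Pi.single q 1) = (ρ.act (wedge (e p) (e q))).baseChange ℂ := by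
  rw [cact_apply, complexAct, Finset.sum_eq_single p, Finset.sum_eq_single q]
  · simp
  · intro b _ hb; simp [hb]
  · simp
  · intro b _ hb; simp [hb]
  · simp

end OrthRep

/-- Identities linear in each argument are thereby reduced to the standard basis, where they come
from `𝔰𝔬(n)` itself. -/
theorem fun_induction {n : ℕ} {P : (Fin n → ℂ) → Prop} (hadd : ∀ a b, P a → P b → P (a + b))
    (hsmul : ∀ (c : ℂ) a, P a → P (c • a)) (hsingle : ∀ p, P (Pi.single p 1)) (h0 : P 0)
    (a : Fin n → ℂ) : P a := by
  rw [pi_eq_sum_univ' a]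
  refine Finset.sum_induction _ P hadd h0 fun p _ => hsmul _ _ ?_
  convert hsingle p using 1

namespace OrthRep

variable {n : ℕ} {V : Type*} [NormedAddCommGroup V] [InnerProductSpace ℝ V] (ρ : OrthRep n V)

theorem cact_swap (a b : Fin n → ℂ) : ρ.cact a b = -ρ.cact b a := by
  induction a using fun_induction with
  | hadd a a' h h' => rw [map_add, LinearMap.add_apply, h, h', map_add]; abel
  | hsmul c a h => rw [map_smul, LinearMap.smul_apply, h, map_smul, smul_neg]
  | h0 => simp
  | hsingle p =>
    induction b using fun_induction with
    | hadd a a' h h' => rw [map_add, h, h', map_add, LinearMap.add_apply]; abel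
    | hsmul c a h => rw [map_smul, h, map_smul, LinearMap.smul_apply, smul_neg]
    | h0 => simp
    | hsingle q => rw [cact_single, cact_single, wedge_swap, map_neg, LinearMap.baseChange_neg]

theorem cact_self (a : Fin n → ℂ) : ρ.cact a a = 0 := by
  have h := ρ.cact_swap a a
  rw [eq_neg_iff_add_eq_zero, ← two_smul ℂ] at h
  exact (smul_eq_zero.1 h).resolve_left two_ne_zero

theorem cact_commutator (a b c d : Fin n → ℂ) :
    ρ.cact a b * ρ.cact c d - ρ.cact c d * ρ.cact a b =
      (a ⬝ᵥ c) • ρ.cact b d - (b ⬝ᵥ c) • ρ.cact a d + (a ⬝ᵥ d) • ρ.cact c b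
        - (b ⬝ᵥ d) • ρ.cact c a := by
  induction a using fun_induction with
  | hadd a a' h h' =>
    simp only [map_add, LinearMap.add_apply, add_mul, mul_add, add_dotProduct, add_smul, smul_add]
    linear_combination (norm := module) h + h'
  | hsmul z a h =>
    simp only [map_smul, LinearMap.smul_apply, smul_mul_assoc, mul_smul_comm, smul_dotProduct,
      smul_eq_mul, mul_smul]
    linear_combination (norm := module) z • h
  | h0 => simp
  | hsingle p =>
  induction b using fun_induction with
  | hadd a a' h h' =>
    simp only [map_add, LinearMap.add_apply, add_mul, mul_add, add_dotProduct, add_smul, smul_add]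
    linear_combination (norm := module) h + h'
  | hsmul z a h =>
    simp only [map_smul, LinearMap.smul_apply, smul_mul_assoc, mul_smul_comm, smul_dotProduct,
      smul_eq_mul, mul_smul]
    linear_combination (norm := module) z • h
  | h0 => simp
  | hsingle q =>
  induction c using fun_induction with
  | hadd a a' h h' =>
    simp only [map_add, LinearMap.add_apply, add_mul, mul_add, dotProduct_add, add_smul, smul_add]
    linear_combination (norm := module) h + h'
  | hsmul z a h =>
    simp only [map_smul, LinearMap.smul_apply, smul_mul_assoc, mul_smul_comm, dotProduct_smul,
      smul_eq_mul, mul_smul]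
    linear_combination (norm := module) z • h
  | h0 => simp
  | hsingle r =>
  induction d using fun_induction with
  | hadd a a' h h' =>
    simp only [map_add, add_mul, mul_add, dotProduct_add, add_smul, smul_add]
    linear_combination (norm := module) h + h'
  | hsmul z a h =>
    simp only [map_smul, smul_mul_assoc, mul_smul_comm, dotProduct_smul,
      smul_eq_mul, mul_smul]
    linear_combination (norm := module) z • h
  | h0 => simp
  | hsingle s =>
    have key := congrArg ρ.act (lie_wedge_e_e p q r s)
    rw [LieHom.map_lie, Ring.lie_def] at key
    simp only [map_sub, map_add, map_smul] at key
    simp only [cact_single]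
    have := congrArg (LinearMap.baseChange ℂ) key
    simp only [LinearMap.baseChange_sub, LinearMap.baseChange_add, LinearMap.baseChange_smul,
      Module.End.mul_eq_comp, LinearMap.baseChange_comp] at this
    rw [Module.End.mul_eq_comp, Module.End.mul_eq_comp, this]
    have hδ : ∀ i j : Fin n, ((Pi.single i 1 : Fin n → ℂ) ⬝ᵥ Pi.single j 1) =
        ((if j = i then (1 : ℝ) else 0 : ℝ) : ℂ) := by
      intro i j
      rw [dotProduct_single, Pi.single_apply]
      split_ifs <;> simp
    simp only [hδ]
    split_ifs <;> simp

/-- Conjugation exchanges the weights `ε_j` and `-ε_j`, so up to sign raising and lowering operators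
are adjoint to each other. -/
theorem inner_cact (a b : Fin n → ℂ) (x y : ℂ ⊗[ℝ] V) :
    inner ℝ (ρ.cact a b x) y = -inner ℝ x (ρ.cact (star a) (star b) y) := by
  induction a using fun_induction generalizing y with
  | hadd a a' h h' =>
    simp only [map_add, star_add, LinearMap.add_apply, inner_add_left, inner_add_right, h, h']
    ring
  | hsmul z a h =>
    simp only [map_smul, star_smul, LinearMap.smul_apply]
    rw [inner_complex_smul_left, h, map_smul]
  | h0 => simp
  | hsingle p =>
  induction b using fun_induction generalizing y with
  | hadd a a' h h' =>
    simp only [map_add, star_add, LinearMap.add_apply, inner_add_left, inner_add_right, h, h']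
    ring
  | hsmul z a h =>
    simp only [map_smul, star_smul, LinearMap.smul_apply]
    rw [inner_complex_smul_left, h, map_smul]
  | h0 => simp
  | hsingle q =>
    have hs : ∀ p : Fin n, star (Pi.single p (1 : ℂ) : Fin n → ℂ) = Pi.single p 1 := by
      intro p
      ext i
      simp [Pi.single_apply, apply_ite]
    rw [hs, hs, cact_single]
    exact inner_baseChange_of_skew (ρ.skew _) x y

end OrthRep

end Kato

namespace Kato

open Matrix

/-! ### Weight vectors of the standard representation -/

/-- The last standard basis vector of `ℂⁿ`. -/
def lastVec (n : ℕ) : Fin n → ℂ := fun p => if (p : ℕ) + 1 = n then 1 else 0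

/-- The index `2j` of the standard basis, counted from `0`. -/
abbrev evenIdx {n : ℕ} (j : Fin (n / 2)) : Fin n := ⟨2 * j, by omega⟩

/-- The index `2j + 1` of the standard basis, counted from `0`. -/
abbrev oddIdx {n : ℕ} (j : Fin (n / 2)) : Fin n := ⟨2 * j + 1, by omega⟩

namespace OrthRep

theorem weightVec_eq {n : ℕ} (j : Fin (n / 2)) (s : ℝ) :
    weightVec n j s =
      Pi.single (evenIdx j) 1 - (s * Complex.I) • Pi.single (oddIdx j) 1 := by
  ext p
  simp only [weightVec, Pi.sub_apply, Pi.smul_apply, Pi.single_apply, Fin.ext_iff, smul_eq_mul]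
  by_cases h : (p : ℕ) = 2 * j
  · simp [h]
  · simp only [h, if_false]
    split_ifs <;> simp

theorem star_weightVec {n : ℕ} (j : Fin (n / 2)) (s : ℝ) :
    star (weightVec n j s) = weightVec n j (-s) := by
  ext p
  simp only [weightVec, Pi.star_apply]
  split_ifs <;> simp

end OrthRep

open OrthRep

theorem star_lastVec (n : ℕ) : star (lastVec n) = lastVec n := by
  ext p
  simp only [lastVec, Pi.star_apply]
  split_ifs <;> simp

theorem lastVec_eq {n : ℕ} (hn : 0 < n) : lastVec n = Pi.single ⟨n - 1, by omega⟩ 1 := by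
  ext p
  simp only [lastVec, Pi.single_apply, Fin.ext_iff]
  congr 1
  apply propext
  omega

theorem dotProduct_weightVec {n : ℕ} (i j : Fin (n / 2)) (s t : ℝ) :
    weightVec n i s ⬝ᵥ weightVec n j t = if i = j then (1 - s * t : ℂ) else 0 := by
  simp only [weightVec_eq, sub_dotProduct, dotProduct_sub, smul_dotProduct, dotProduct_smul,
    single_dotProduct, one_mul, Pi.single_apply, Fin.ext_iff, smul_eq_mul]
  by_cases h : (i : ℕ) = j
  · simp only [h, if_true]
    rw [if_neg (by omega), if_neg (by omega)]
    linear_combination (s * t : ℂ) * Complex.I_mul_I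
  · rw [if_neg (by omega), if_neg (by omega), if_neg (by omega), if_neg (by omega), if_neg h]
    simp

theorem dotProduct_lastVec {n : ℕ} (hn : Odd n) (i : Fin (n / 2)) (s : ℝ) :
    weightVec n i s ⬝ᵥ lastVec n = 0 := by
  obtain ⟨m, hm⟩ := hn
  simp only [weightVec_eq, sub_dotProduct, smul_dotProduct, single_dotProduct, one_mul, lastVec]
  rw [if_neg (by omega), if_neg (by omega)]
  simp

theorem lastVec_dotProduct {n : ℕ} (hn : Odd n) (i : Fin (n / 2)) (s : ℝ) :
    lastVec n ⬝ᵥ weightVec n i s = 0 := by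
  rw [dotProduct_comm, dotProduct_lastVec hn]

theorem lastVec_dotProduct_self {n : ℕ} (hn : 0 < n) : lastVec n ⬝ᵥ lastVec n = 1 := by
  simp [lastVec_eq hn]

theorem sum_fin_pairs {W : Type*} [AddCommMonoid W] {n : ℕ} (f : Fin n → W) :
    ∑ k, f k = ∑ l : Fin (n / 2), (f (evenIdx l) + f (oddIdx l)) +
      if h : Odd n then f ⟨n - 1, by obtain ⟨m, hm⟩ := h; omega⟩ else 0 := by
  set g : ℕ → W := fun k => if h : k < n then f ⟨k, h⟩ else 0 with hg
  have h1 : ∀ k : Fin n, f k = g k := fun k => by simp [hg]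
  have h2 : ∀ (g : ℕ → W) (m : ℕ), ∑ k ∈ Finset.range (2 * m), g k =
      ∑ l ∈ Finset.range m, (g (2 * l) + g (2 * l + 1)) := by
    intro g m
    induction m with
    | zero => simp
    | succ m ih =>
      rw [show 2 * (m + 1) = 2 * m + 1 + 1 by ring, Finset.sum_range_succ, Finset.sum_range_succ,
        Finset.sum_range_succ, ih, add_assoc]
  simp only [h1]
  rw [Fin.sum_univ_eq_sum_range (fun k => g k),
    Fin.sum_univ_eq_sum_range (fun l => g (2 * l) + g (2 * l + 1)), ← h2]
  rcases Nat.even_or_odd n with h | h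
  · rw [dif_neg (Nat.not_odd_iff_even.2 h), add_zero, Nat.two_mul_div_two_of_even h]
  · have h3 : n - 1 = 2 * (n / 2) := by obtain ⟨m, hm⟩ := h; omega
    rw [dif_pos h, h3, ← Finset.sum_range_succ]
    congr 2
    obtain ⟨m, hm⟩ := h; omega

theorem single_evenIdx {n : ℕ} (j : Fin (n / 2)) {s : ℝ} :
    (Pi.single (evenIdx j) 1 : Fin n → ℂ) =
      (1 / 2 : ℂ) • (weightVec n j s + weightVec n j (-s)) := by
  rw [weightVec_eq, weightVec_eq]
  push_cast
  module

theorem single_oddIdx {n : ℕ} (j : Fin (n / 2)) {s : ℝ} (hs : s * s = 1) :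
    (Pi.single (oddIdx j) 1 : Fin n → ℂ) =
      (s * Complex.I / 2 : ℂ) • (weightVec n j s - weightVec n j (-s)) := by
  have hs' : (s : ℂ) * s = 1 := by exact_mod_cast hs
  have : (s * Complex.I) * (s * Complex.I) = -1 := by
    linear_combination (s * s : ℂ) * Complex.I_mul_I - hs'
  rw [weightVec_eq, weightVec_eq]
  push_cast
  linear_combination (norm := module) this • (Pi.single (oddIdx j) 1 : Fin n → ℂ)

/-- This expands the invariant tensor `∑ e_k ⊗ e_k` in the isotropic basis; the factor `1/2` is
there because `u_l^σ ⬝ᵥ u_l^{-σ} = 2`. The signs `σ` stay free since the pure vector of weight `(k,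
…, k, -k)` needs the opposite isotropic line in the last plane. -/
theorem sum_single_eq {W : Type*} [AddCommGroup W] [Module ℂ W] {n : ℕ}
    (Φ : (Fin n → ℂ) →ₗ[ℂ] (Fin n → ℂ) →ₗ[ℂ] W) {σ : Fin (n / 2) → ℝ} (hσ : ∀ l, σ l * σ l = 1) :
    ∑ k, Φ (Pi.single k 1) (Pi.single k 1) =
      (1 / 2 : ℂ) • ∑ l, (Φ (weightVec n l (σ l)) (weightVec n l (-σ l)) +
        Φ (weightVec n l (-σ l)) (weightVec n l (σ l))) +
      if Odd n then Φ (lastVec n) (lastVec n) else 0 := by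
  rw [sum_fin_pairs, Finset.smul_sum]
  congr 1
  · refine Finset.sum_congr rfl fun l _ => ?_
    have hs' : (σ l : ℂ) * σ l = 1 := by exact_mod_cast hσ l
    have : (σ l * Complex.I) * (σ l * Complex.I) = -1 := by
      linear_combination (σ l * σ l : ℂ) * Complex.I_mul_I - hs'
    simp only [weightVec_eq, map_sub, map_smul, LinearMap.sub_apply, LinearMap.smul_apply]
    push_cast
    linear_combination (norm := module)
      this • Φ (Pi.single (oddIdx l) 1) (Pi.single (oddIdx l) 1)
  · split_ifs with h
    · rw [lastVec_eq h.pos]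
    · rfl

theorem eq_zero_of_weightVec {W : Type*} [AddCommGroup W] [Module ℂ W] {n : ℕ}
    (φ : (Fin n → ℂ) →ₗ[ℂ] W) {σ : Fin (n / 2) → ℝ} (hσ : ∀ l, σ l * σ l = 1)
    (h1 : ∀ l, φ (weightVec n l (σ l)) = 0) (h2 : ∀ l, φ (weightVec n l (-σ l)) = 0)
    (h3 : Odd n → φ (lastVec n) = 0) (a : Fin n → ℂ) : φ a = 0 := by
  induction a using fun_induction with
  | hadd a a' h h' => rw [map_add, h, h', add_zero]
  | hsmul c a h => rw [map_smul, h, smul_zero]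
  | h0 => simp
  | hsingle p =>
    by_cases hp : (p : ℕ) / 2 < n / 2
    · rcases Nat.even_or_odd' (p : ℕ) with ⟨l, h | h⟩
      · have : p = evenIdx ⟨l, by omega⟩ := by ext; simp [h]
        rw [this, single_evenIdx _ (s := σ ⟨l, by omega⟩), map_smul, map_add, h1, h2]
        simp
      · have : p = oddIdx ⟨l, by omega⟩ := by ext; simp [h]
        rw [this, single_oddIdx _ (hσ ⟨l, by omega⟩), map_smul, map_sub, h1, h2]
        simp
    · have hn : Odd n := by
        rw [← Nat.not_even_iff_odd]
        rintro ⟨m, hm⟩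
        omega
      have := h3 hn
      rw [lastVec_eq hn.pos] at this
      convert this using 4
      omega

/-! ### The quadratic relation -/

namespace OrthRep

variable {n : ℕ} {V : Type*} [NormedAddCommGroup V] [InnerProductSpace ℝ V] (ρ : OrthRep n V)

/-- The matrix entries of `B² - s B + p`. -/
noncomputable def quad (s p : ℝ) (i j : Fin n) : Module.End ℝ V :=
  ∑ k, ρ.act (wedge (e i) (e k)) * ρ.act (wedge (e k) (e j)) - s • ρ.act (wedge (e i) (e j)) +
    (if i = j then p else 0) • 1

/-- The complexified entries of `B²`. -/
noncomputable def cquad : (Fin n → ℂ) →ₗ[ℂ] (Fin n → ℂ) →ₗ[ℂ] Module.End ℂ (ℂ ⊗[ℝ] V) :=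
  ∑ k, (LinearMap.mul ℂ (Module.End ℂ (ℂ ⊗[ℝ] V))).compl₁₂
    (ρ.cact.flip (Pi.single k 1)) (ρ.cact (Pi.single k 1))

theorem cquad_apply (a b : Fin n → ℂ) :
    ρ.cquad a b = ∑ k, ρ.cact a (Pi.single k 1) * ρ.cact (Pi.single k 1) b := by
  simp [cquad, LinearMap.sum_apply]

/-- The bilinear map `(x, y) ↦ R(a, x) R(y, b) v`. -/
noncomputable def cactPair (a b : Fin n → ℂ) (v : ℂ ⊗[ℝ] V) :
    (Fin n → ℂ) →ₗ[ℂ] (Fin n → ℂ) →ₗ[ℂ] ℂ ⊗[ℝ] V :=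
  LinearMap.mk₂ ℂ (fun x y => ρ.cact a x (ρ.cact y b v))
    (fun x y z => by rw [map_add, LinearMap.add_apply])
    (fun c x y => by rw [map_smul, LinearMap.smul_apply])
    (fun x y z => by rw [map_add, LinearMap.add_apply, LinearMap.add_apply, map_add])
    (fun c x y => by rw [map_smul, LinearMap.smul_apply, LinearMap.smul_apply, map_smul])

theorem cquad_apply_eq {σ : Fin (n / 2) → ℝ} (hσ : ∀ l, σ l * σ l = 1) (a b : Fin n → ℂ)
    (v : ℂ ⊗[ℝ] V) :
    ρ.cquad a b v =
      (1 / 2 : ℂ) • ∑ l,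
        (ρ.cact a (weightVec n l (σ l)) (ρ.cact (weightVec n l (-σ l)) b v) +
          ρ.cact a (weightVec n l (-σ l)) (ρ.cact (weightVec n l (σ l)) b v)) +
      if Odd n then ρ.cact a (lastVec n) (ρ.cact (lastVec n) b v) else 0 := by
  rw [cquad_apply, LinearMap.sum_apply]
  exact sum_single_eq (ρ.cactPair a b v) hσ

/-- The complexified entries of `B² - s B + p`. -/
noncomputable def cpoly (s p : ℂ) (a b : Fin n → ℂ) : Module.End ℂ (ℂ ⊗[ℝ] V) :=
  ρ.cquad a b - s • ρ.cact a b + (p * (a ⬝ᵥ b)) • 1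

theorem cpoly_single (s p : ℝ) (i j : Fin n) :
    ρ.cpoly s p (Pi.single i 1) (Pi.single j 1) = (ρ.quad s p i j).baseChange ℂ := by
  have h1 : ∀ i j (v : V), ρ.cact (Pi.single i 1) (Pi.single j 1) ((1 : ℂ) ⊗ₜ v) =
      (1 : ℂ) ⊗ₜ ρ.act (wedge (e i) (e j)) v := fun i j v => by
    rw [cact_single, LinearMap.baseChange_tmul]
  have h2 : (Pi.single i (1 : ℂ) : Fin n → ℂ) ⬝ᵥ Pi.single j 1 = if i = j then 1 else 0 := by
    rw [single_dotProduct, Pi.single_apply, one_mul]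
  ext v
  simp only [TensorProduct.AlgebraTensorModule.curry_apply, TensorProduct.curry_apply, LinearMap.coe_restrictScalars, LinearMap.baseChange_tmul,
    cpoly, quad, cquad_apply, LinearMap.add_apply, LinearMap.sub_apply, LinearMap.smul_apply,
    LinearMap.sum_apply, Module.End.mul_apply, Module.End.one_apply, h1, h2,
    TensorProduct.tmul_add, TensorProduct.tmul_sub, TensorProduct.tmul_sum]
  congr 1
  · rw [← TensorProduct.smul_tmul, TensorProduct.smul_tmul']
    simp
  · rw [← TensorProduct.smul_tmul, TensorProduct.smul_tmul']
    split_ifs <;> simp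

theorem cpoly_eq_zero {s p : ℝ} (h : ∀ i j, ρ.quad s p i j = 0) (a b : Fin n → ℂ) :
    ρ.cpoly s p a b = 0 := by
  induction a using fun_induction with
  | hadd a a' h h' =>
    rw [cpoly] at h h' ⊢
    simp only [map_add, LinearMap.add_apply, add_dotProduct, smul_add, mul_add, add_smul]
    linear_combination (norm := module) h + h'
  | hsmul c a h =>
    rw [cpoly] at h ⊢
    simp only [map_smul, LinearMap.smul_apply, smul_dotProduct, smul_eq_mul]
    linear_combination (norm := module) c • h
  | h0 => simp [cpoly]
  | hsingle i =>
  induction b using fun_induction with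
  | hadd a a' h h' =>
    rw [cpoly] at h h' ⊢
    simp only [map_add, dotProduct_add, smul_add, mul_add, add_smul]
    linear_combination (norm := module) h + h'
  | hsmul c a h =>
    rw [cpoly] at h ⊢
    simp only [map_smul, dotProduct_smul, smul_eq_mul]
    linear_combination (norm := module) c • h
  | h0 => simp [cpoly]
  | hsingle j => rw [cpoly_single, h, LinearMap.baseChange_zero]

/-- Swapping both factors costs two signs, so each summand of the difference is the commutator of
`R(a, e_k)` and `R(e_k, b)`. Summed over `k`, its terms contribute `1`, `-n` and `1` times `R(a,
b)`. -/
theorem cquad_sub_swap (a b : Fin n → ℂ) :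
    ρ.cquad a b - ρ.cquad b a = (2 - n : ℂ) • ρ.cact a b := by
  rw [cquad_apply, cquad_apply, ← Finset.sum_sub_distrib]
  have hneg : ∀ X Y : Module.End ℂ (ℂ ⊗[ℝ] V), -X * -Y = X * Y := fun X Y => by ext; simp
  have : ∀ k : Fin n, ρ.cact a (Pi.single k 1) * ρ.cact (Pi.single k 1) b -
      ρ.cact b (Pi.single k 1) * ρ.cact (Pi.single k 1) a =
      ρ.cact (a k • Pi.single k 1) b - ρ.cact a b - ρ.cact (b k • Pi.single k 1) a := by
    intro k
    rw [ρ.cact_swap b, ρ.cact_swap _ a, hneg, cact_commutator, cact_self]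
    simp
  have hk : ∀ a : Fin n → ℂ, ∑ k, a k • (Pi.single k 1 : Fin n → ℂ) = a := by
    intro a
    ext i
    simp [Finset.sum_apply, Pi.single_apply]
  have h3 : ∀ a b : Fin n → ℂ, ∑ k, ρ.cact (a k • Pi.single k 1) b = ρ.cact a b := by
    intro a b
    rw [← LinearMap.sum_apply, ← map_sum, hk]
  rw [Finset.sum_congr rfl fun k _ => this k, Finset.sum_sub_distrib, Finset.sum_sub_distrib,
    h3 a b, h3 b a, ρ.cact_swap b a]
  simp only [Finset.sum_const, Finset.card_univ, Fintype.card_fin]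
  module

/-- For this `s` the antisymmetric part of the quadratic expression cancels, which halves the
entries to be checked on a pure vector. -/
theorem cpoly_swap {s : ℂ} (hs : s = 1 - n / 2) (p : ℂ) (a b : Fin n → ℂ) :
    ρ.cpoly s p a b = ρ.cpoly s p b a := by
  have := ρ.cquad_sub_swap a b
  rw [cpoly, cpoly, dotProduct_comm b a, ρ.cact_swap b a, hs]
  linear_combination (norm := module) this

theorem norm_sq_cact {a b : Fin n → ℂ} {v : ℂ ⊗[ℝ] V} {c : ℝ}
    (hc : ρ.cact a b (ρ.cact (star a) (star b) v) = (c : ℂ) • v) :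
    ‖ρ.cact (star a) (star b) v‖ ^ 2 = -c * ‖v‖ ^ 2 := by
  rw [← real_inner_self_eq_norm_sq, inner_cact, star_star, star_star, hc,
    inner_ofReal_smul_right, neg_mul]
  exact congrArg (fun t => -(c * t)) (real_inner_self_eq_norm_sq v)

theorem cact_cact_comm (a b c d : Fin n → ℂ) (v : ℂ ⊗[ℝ] V) :
    ρ.cact a b (ρ.cact c d v) = ρ.cact c d (ρ.cact a b v) +
      ((a ⬝ᵥ c) • ρ.cact b d v - (b ⬝ᵥ c) • ρ.cact a d v + (a ⬝ᵥ d) • ρ.cact c b v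
        - (b ⬝ᵥ d) • ρ.cact c a v) := by
  have := LinearMap.congr_fun (ρ.cact_commutator a b c d) v
  simp only [LinearMap.sub_apply, LinearMap.add_apply, LinearMap.smul_apply,
    Module.End.mul_apply] at this
  rw [← this]
  abel

end OrthRep

end Kato

namespace Kato

namespace OrthRep

open Matrix

/-! ### Highest weight vectors -/

variable {n : ℕ} {V : Type*} [NormedAddCommGroup V] [InnerProductSpace ℝ V] {ρ : OrthRep n V}

variable (ρ) in
/-- `v` is a highest weight vector of weight `lam`. -/
structure IsHighestWeightVector (lam : Fin (n / 2) → ℝ) (v : ℂ ⊗[ℝ] V) : Prop where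
  ne_zero : v ≠ 0
  weight : ∀ (i : Fin (n / 2)) (s t : ℝ),
    ρ.cact (weightVec n i s) (weightVec n i t) v = (((t - s) * lam i : ℝ) : ℂ) • v
  pos : ∀ i j : Fin (n / 2), i < j → ∀ s : ℝ, s * s = 1 →
    ρ.cact (weightVec n i 1) (weightVec n j s) v = 0
  pos_last : Odd n → ∀ i : Fin (n / 2), ρ.cact (weightVec n i 1) (lastVec n) v = 0

theorem IsHighestWeight.exists_vector {lam : Fin (n / 2) → ℝ} (h : ρ.IsHighestWeight lam) :
    ∃ v, ρ.IsHighestWeightVector lam v := by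
  obtain ⟨v, hv, hw, hp, hl⟩ := h
  refine ⟨v, hv, fun i s t => ?_, fun i j hij s hs => hp i j hij s ?_, hl⟩
  · have h1 : ρ.cact (Pi.single (evenIdx i) 1) (Pi.single (oddIdx i) 1) v =
        (Complex.I * (lam i : ℂ)) • v := by rw [cact_single]; exact hw i
    have h2 := LinearMap.congr_fun (ρ.cact_swap (Pi.single (oddIdx i) 1) (Pi.single (evenIdx i) 1)) v
    rw [LinearMap.neg_apply, h1] at h2
    simp only [weightVec_eq, map_sub, map_smul, LinearMap.sub_apply, LinearMap.smul_apply,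
      cact_self, h1, h2, LinearMap.zero_apply]
    push_cast
    have hI : ((s - t) * lam i : ℂ) * (Complex.I * Complex.I) = (s - t) * lam i * -1 := by
      rw [Complex.I_mul_I]
    linear_combination (norm := module) hI • v
  · exact mul_self_eq_one_iff.1 hs

namespace IsHighestWeightVector

variable {lam : Fin (n / 2) → ℝ} {v : ℂ ⊗[ℝ] V} (h : ρ.IsHighestWeightVector lam v)
include h

theorem pos' {i j : Fin (n / 2)} (hij : j < i) {s : ℝ} (hs : s * s = 1) :
    ρ.cact (weightVec n i s) (weightVec n j 1) v = 0 := by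
  rw [cact_swap, LinearMap.neg_apply, h.pos _ _ hij s hs, neg_zero]

theorem pos_last' (hn : Odd n) (i : Fin (n / 2)) :
    ρ.cact (lastVec n) (weightVec n i 1) v = 0 := by
  rw [cact_swap, LinearMap.neg_apply, h.pos_last hn, neg_zero]

/-- The norm of the lowered vector is computed by raising it again. The raising operator kills `v`,
so only the Cartan part of the commutator survives. Nonnegativity gives dominance of `lam`; a zero
value makes the lowering operator kill `v`. -/
theorem norm_sq_neg {l i : Fin (n / 2)} (hli : l < i) {s : ℝ} (hs : s * s = 1) :
    ‖ρ.cact (weightVec n l (-1)) (weightVec n i (-s)) v‖ ^ 2 =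
      4 * (lam l + s * lam i) * ‖v‖ ^ 2 := by
  have hs' : (s : ℂ) * s = 1 := by exact_mod_cast hs
  have := ρ.norm_sq_cact (a := weightVec n l 1) (b := weightVec n i s) (v := v)
    (c := -(4 * (lam l + s * lam i))) (by
      rw [star_weightVec, star_weightVec, cact_cact_comm, h.pos _ _ hli s hs, h.weight, h.weight,
        dotProduct_weightVec, dotProduct_weightVec, dotProduct_weightVec, dotProduct_weightVec,
        if_neg hli.ne, if_neg hli.ne', if_pos rfl, if_pos rfl]
      push_cast
      have hX : (-2 * lam l : ℂ) * (s * s) = -2 * lam l := by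
        rw [hs', mul_one]
      rw [map_zero]
      linear_combination (norm := module) hX • v)
  rw [star_weightVec, star_weightVec] at this
  rw [this]
  ring

theorem norm_sq_neg_last (hn : Odd n) (i : Fin (n / 2)) :
    ‖ρ.cact (weightVec n i (-1)) (lastVec n) v‖ ^ 2 = 2 * lam i * ‖v‖ ^ 2 := by
  have := ρ.norm_sq_cact (a := weightVec n i 1) (b := lastVec n) (v := v)
    (c := -(2 * lam i)) (by
      rw [star_weightVec, star_lastVec, cact_cact_comm, h.pos_last hn, h.weight, cact_self,
        dotProduct_weightVec, dotProduct_lastVec hn, lastVec_dotProduct hn,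
        lastVec_dotProduct_self hn.pos]
      push_cast
      simp only [map_zero, zero_smul, LinearMap.zero_apply, smul_zero]
      module)
  rw [star_weightVec, star_lastVec] at this
  rw [this]
  ring

theorem norm_sq_pos : 0 < ‖v‖ ^ 2 := by
  have := norm_pos_iff.2 h.ne_zero
  positivity

theorem add_nonneg {l i : Fin (n / 2)} (hli : l < i) {s : ℝ} (hs : s * s = 1) :
    0 ≤ lam l + s * lam i := by
  have h1 := h.norm_sq_neg hli hs
  have h2 := h.norm_sq_pos
  by_contra hc
  push Not at hc
  nlinarith [sq_nonneg ‖ρ.cact (weightVec n l (-1)) (weightVec n i (-s)) v‖,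
    mul_neg_of_neg_of_pos hc h2]

theorem nonneg_of_lt {l i : Fin (n / 2)} (hli : l < i) : 0 ≤ lam l := by
  have h1 := h.add_nonneg hli (s := 1) (by norm_num)
  have h2 := h.add_nonneg hli (s := -1) (by norm_num)
  linarith

theorem nonneg_of_odd (hn : Odd n) (i : Fin (n / 2)) : 0 ≤ lam i := by
  have h1 := h.norm_sq_neg_last hn i
  have h2 := h.norm_sq_pos
  by_contra hc
  push Not at hc
  nlinarith [sq_nonneg ‖ρ.cact (weightVec n i (-1)) (lastVec n) v‖,
    mul_neg_of_neg_of_pos hc h2]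

theorem ofReal_smul_eq_zero {c : ℝ} (hc : (c : ℂ) • v = 0) : c = 0 := by
  exact_mod_cast (smul_eq_zero.1 hc).resolve_right h.ne_zero

/-- This is the entry at `(u_i^-, u_i^+)`. Indices `l > i` contribute nothing, `l = i` gives the
square of the Cartan action, and `l < i` leaves a commutator with the lowering operator of root `ε_i
- ε_l`. -/
theorem quadratic_eq {s p : ℝ} (hT : ∀ i j, ρ.quad s p i j = 0) (i : Fin (n / 2)) :
    lam i * lam i - s * lam i + p = -∑ l ∈ Finset.Iio i, (lam l - lam i) := by
  have h0 := LinearMap.congr_fun (ρ.cpoly_eq_zero hT (weightVec n i (-1)) (weightVec n i 1)) v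
  have hσ : ∀ l : Fin (n / 2), (fun _ : Fin (n / 2) => (1 : ℝ)) l * (fun _ => 1) l = 1 := by simp
  have hterm : ∀ l : Fin (n / 2),
      ρ.cact (weightVec n i (-1)) (weightVec n l 1)
          (ρ.cact (weightVec n l (-1)) (weightVec n i 1) v) +
        ρ.cact (weightVec n i (-1)) (weightVec n l (-1))
          (ρ.cact (weightVec n l 1) (weightVec n i 1) v) =
      (((if l < i then 4 * (lam l - lam i) else 0) +
        (if l = i then 4 * (lam i * lam i) else 0) : ℝ) : ℂ) • v := by
    intro l
    rcases lt_trichotomy l i with hl | hl | hl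
    · rw [h.pos l i hl 1 (by norm_num), map_zero, add_zero, if_pos hl, if_neg hl.ne,
        cact_cact_comm, h.pos' hl (by norm_num), h.weight, h.weight,
        dotProduct_weightVec, dotProduct_weightVec, dotProduct_weightVec, dotProduct_weightVec,
        if_neg hl.ne', if_neg hl.ne, if_pos rfl, if_pos rfl]
      push_cast
      simp only [map_zero]
      module
    · subst hl
      rw [cact_self, h.weight, map_smul, h.weight]
      simp only [lt_irrefl, if_false, if_true, LinearMap.zero_apply]
      push_cast
      module
    · rw [h.pos' hl (by norm_num), h.pos' hl (by norm_num), if_neg (lt_asymm hl), if_neg hl.ne']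
      simp
  rw [cpoly] at h0
  simp only [LinearMap.add_apply, LinearMap.sub_apply, LinearMap.smul_apply,
    Module.End.one_apply, LinearMap.zero_apply] at h0
  rw [ρ.cquad_apply_eq hσ, h.weight, dotProduct_weightVec, if_pos rfl,
    Finset.sum_congr rfl fun l _ => hterm l, ← Finset.sum_smul, ← Complex.ofReal_sum] at h0
  have h1 : (if Odd n then ρ.cact (weightVec n i (-1)) (lastVec n)
      (ρ.cact (lastVec n) (weightVec n i 1) v) else 0) = 0 := by
    split_ifs with hn
    · rw [h.pos_last' hn, map_zero]
    · rfl
  rw [h1, Finset.sum_add_distrib, Finset.sum_ite_eq' Finset.univ i, if_pos (Finset.mem_univ i),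
    ← Finset.sum_filter] at h0
  have hf : Finset.univ.filter (fun l => l < i) = Finset.Iio i := by ext; simp
  rw [hf, ← Finset.mul_sum] at h0
  set S := ∑ l ∈ Finset.Iio i, (lam l - lam i) with hS
  have h2 : ((2 * S + 2 * (lam i * lam i) - 2 * s * lam i + 2 * p : ℝ) : ℂ) • v = 0 := by
    rw [← h0]
    push_cast
    module
  have h3 := h.ofReal_smul_eq_zero h2
  linarith

/-- This is the entry at the zero weight vector, with itself in both slots; it is the extra equation
that pins down `k` for odd `n`. -/
theorem sum_eq {s p : ℝ} (hT : ∀ i j, ρ.quad s p i j = 0) (hn : Odd n) :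
    ∑ l, lam l + p = 0 := by
  have h0 := LinearMap.congr_fun (ρ.cpoly_eq_zero hT (lastVec n) (lastVec n)) v
  have hσ : ∀ l : Fin (n / 2), (fun _ : Fin (n / 2) => (1 : ℝ)) l * (fun _ => 1) l = 1 := by simp
  have hterm : ∀ l : Fin (n / 2),
      ρ.cact (lastVec n) (weightVec n l 1) (ρ.cact (weightVec n l (-1)) (lastVec n) v) +
        ρ.cact (lastVec n) (weightVec n l (-1)) (ρ.cact (weightVec n l 1) (lastVec n) v) =
      ((2 * lam l : ℝ) : ℂ) • v := by
    intro l
    rw [h.pos_last hn, map_zero, add_zero, cact_cact_comm, h.pos_last' hn, h.weight, cact_self,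
      dotProduct_weightVec, lastVec_dotProduct hn, lastVec_dotProduct_self hn.pos,
      dotProduct_lastVec hn]
    push_cast
    simp only [map_zero, zero_smul, LinearMap.zero_apply, smul_zero]
    module
  rw [cpoly] at h0
  simp only [LinearMap.add_apply, LinearMap.sub_apply, LinearMap.smul_apply,
    Module.End.one_apply, LinearMap.zero_apply] at h0
  rw [ρ.cquad_apply_eq hσ, cact_self, lastVec_dotProduct_self hn.pos,
    Finset.sum_congr rfl fun l _ => hterm l, ← Finset.sum_smul, ← Complex.ofReal_sum, if_pos hn,
    ← Finset.mul_sum] at h0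
  refine h.ofReal_smul_eq_zero ?_
  rw [← h0]
  push_cast
  simp only [LinearMap.zero_apply, smul_zero]
  module

/-- A representation whose conformal weights are `k > 0` and `s - k`, `s = 1 - n / 2`, has one of
the highest weights of the classification. -/
theorem weight_of_quad {w₁ w₂ : ℝ} (hsum : w₁ + w₂ = 1 - n / 2) (h1 : 0 < w₁)
    (hT : ∀ i j, ρ.quad (w₁ + w₂) (w₁ * w₂) i j = 0) :
    IsHalfSpinPowerWeight n lam w₁ ∨ IsSpinWeight n lam w₁ := by
  -- Strong induction over the coordinates: any `l < i` lies before the last place, so the first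
  -- clause gives `lam l = w₁` there.
  have key : ∀ i : Fin (n / 2), ((i : ℕ) + 1 < n / 2 ∨ Odd n → lam i = w₁) ∧
      (lam i = w₁ ∨ lam i = w₂ + i) := by
    intro i
    induction i using WellFoundedLT.induction with
    | ind i ih =>
      have hq := h.quadratic_eq hT i
      have hc : ∑ l ∈ Finset.Iio i, (lam l - lam i) = i * (w₁ - lam i) := by
        rw [Finset.sum_congr rfl fun l hl => by
          have hl' : l < i := Finset.mem_Iio.1 hl
          rw [(ih l hl').1 (Or.inl (by have := i.2; have : (l : ℕ) < i := hl'; omega))]]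
        simp [mul_sub]
      rw [hc] at hq
      -- With all earlier coordinates equal to `w₁`, the right-hand side is linear in `lam i` and
      -- the quadratic factors.
      have hprod : (lam i - w₁) * (lam i - (w₂ + i)) = 0 := by linear_combination hq
      have hor : lam i = w₁ ∨ lam i = w₂ + i := by
        rcases mul_eq_zero.1 hprod with h | h
        · exact Or.inl (by linarith)
        · exact Or.inr (by linarith)
      refine ⟨fun hi => hor.resolve_right fun hlam => ?_, hor⟩
      have h0 : 0 ≤ lam i := by
        rcases hi with hi | hi
        · exact h.nonneg_of_lt (i := ⟨i + 1, hi⟩) (Fin.lt_def.2 (Nat.lt_succ_self _))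
        · exact h.nonneg_of_odd hi i
      -- As `i + 1 ≤ n/2`, the root `w₂ + i = 1 - n/2 - w₁ + i` is at most `-w₁ < 0`, against `h0`.
      have hi' : ((i : ℕ) : ℝ) + 1 ≤ n / 2 := by
        have h3 : 2 * ((i : ℕ) + 1) ≤ n := by have := i.2; omega
        have : (2 * ((i : ℕ) + 1) : ℝ) ≤ n := by exact_mod_cast h3
        linarith
      linarith
  rcases Nat.even_or_odd n with he | ho
  · refine Or.inl ⟨he, h1, fun i => ⟨fun hi => (key i).1 (Or.inl hi), fun hi => ?_⟩⟩
    refine (key i).2.imp_right fun hlam => ?_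
    have h3 : 2 * ((i : ℕ) + 1) = n := by rw [hi, Nat.two_mul_div_two_of_even he]
    have : (2 * ((i : ℕ) + 1) : ℝ) = n := by exact_mod_cast h3
    linarith
  · have hall : ∀ i, lam i = w₁ := fun i => (key i).1 (Or.inr ho)
    refine Or.inr ⟨ho, ?_, hall⟩
    have hs := h.sum_eq hT ho
    simp only [hall, Finset.sum_const, Finset.card_univ, Fintype.card_fin, nsmul_eq_mul] at hs
    -- The zero weight entry reads `m w₁ + w₁ w₂ = 0` with `m = ⌊n/2⌋`, so `w₂ = -m` and `w₁ = 1 -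
    -- n/2 + m = 1/2`.
    have h3 : ((n / 2 : ℕ) : ℝ) + w₂ = 0 := by
      have : w₁ * (((n / 2 : ℕ) : ℝ) + w₂) = 0 := by linear_combination hs
      exact (mul_eq_zero.1 this).resolve_left h1.ne'
    have h4 : (2 * (n / 2 : ℕ) + 1 : ℝ) = n := by exact_mod_cast Nat.two_mul_div_two_add_one_of_odd ho
    linarith

end IsHighestWeightVector

end OrthRep

end Kato

namespace Kato

namespace OrthRep

open Matrix

theorem natCast_eq_of_odd {n : ℕ} (hn : Odd n) : (n : ℂ) = 2 * (n / 2 : ℕ) + 1 := by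
  exact_mod_cast (Nat.two_mul_div_two_add_one_of_odd hn).symm

/-! ### The quadratic relation for the weights of the classification -/

variable {n : ℕ} {V : Type*} [NormedAddCommGroup V] [InnerProductSpace ℝ V] {ρ : OrthRep n V}

variable (ρ) in
/-- `v` is annihilated by the root vectors of the parabolic subalgebra stabilizing the maximal
isotropic subspace spanned by the `e_{2j-1} - σ_j i e_{2j}`, on the Levi factor of which it has
the weight `k` times the trace. -/
structure IsPureVector (σ : Fin (n / 2) → ℝ) (k : ℝ) (v : ℂ ⊗[ℝ] V) : Prop where
  sign : ∀ l, σ l * σ l = 1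
  pos_pos : ∀ l i, ρ.cact (weightVec n l (σ l)) (weightVec n i (σ i)) v = 0
  neg_pos : ∀ l i, ρ.cact (weightVec n l (-σ l)) (weightVec n i (σ i)) v =
    (if l = i then 2 * k else 0 : ℂ) • v
  last_pos : Odd n → ∀ i, ρ.cact (lastVec n) (weightVec n i (σ i)) v = 0
  eq_half : Odd n → k = 1 / 2

namespace IsPureVector

variable {σ : Fin (n / 2) → ℝ} {k : ℝ} {v : ℂ ⊗[ℝ] V} (h : ρ.IsPureVector σ k v)
include h

theorem sign_complex (l : Fin (n / 2)) : (σ l : ℂ) * σ l = 1 := by exact_mod_cast h.sign l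

theorem dot_pos_pos (l i : Fin (n / 2)) :
    weightVec n l (σ l) ⬝ᵥ weightVec n i (σ i) = 0 := by
  rw [dotProduct_weightVec]
  split_ifs with hl
  · subst hl
    linear_combination -h.sign_complex l
  · rfl

theorem dot_neg_neg (l i : Fin (n / 2)) :
    weightVec n l (-σ l) ⬝ᵥ weightVec n i (-σ i) = 0 := by
  rw [dotProduct_weightVec]
  split_ifs with hl
  · subst hl
    push_cast
    linear_combination -h.sign_complex l
  · rfl

theorem dot_neg_pos (l i : Fin (n / 2)) :
    weightVec n l (-σ l) ⬝ᵥ weightVec n i (σ i) = if l = i then 2 else 0 := by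
  rw [dotProduct_weightVec]
  split_ifs with hl
  · subst hl
    push_cast
    linear_combination h.sign_complex l
  · rfl

theorem dot_pos_neg (l i : Fin (n / 2)) :
    weightVec n l (σ l) ⬝ᵥ weightVec n i (-σ i) = if l = i then 2 else 0 := by
  rw [dotProduct_comm, h.dot_neg_pos]
  simp only [eq_comm]

theorem pos_neg (l i : Fin (n / 2)) :
    ρ.cact (weightVec n l (σ l)) (weightVec n i (-σ i)) v =
      (if l = i then -(2 * k) else 0 : ℂ) • v := by
  rw [cact_swap, LinearMap.neg_apply, h.neg_pos, ← neg_smul]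
  congr 1
  by_cases hl : l = i
  · rw [if_pos hl, if_pos hl.symm]
  · rw [if_neg hl, if_neg (Ne.symm hl), neg_zero]

theorem pos_last (hn : Odd n) (i : Fin (n / 2)) :
    ρ.cact (weightVec n i (σ i)) (lastVec n) v = 0 := by
  rw [cact_swap, LinearMap.neg_apply, h.last_pos hn, neg_zero]

/-- The conditions defining a pure vector say this on the isotropic basis; linearity in `a` gives
one formula for all `a`. -/
theorem cact_pos (a : Fin n → ℂ) (i : Fin (n / 2)) :
    ρ.cact a (weightVec n i (σ i)) v = (k * (a ⬝ᵥ weightVec n i (σ i)) : ℂ) • v := by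
  set φ : (Fin n → ℂ) →ₗ[ℂ] ℂ ⊗[ℝ] V :=
    { toFun := fun a => ρ.cact a (weightVec n i (σ i)) v -
        (k * (a ⬝ᵥ weightVec n i (σ i)) : ℂ) • v
      map_add' := fun a b => by
        simp only [map_add, LinearMap.add_apply, add_dotProduct]
        module
      map_smul' := fun c a => by
        simp only [map_smul, LinearMap.smul_apply, smul_dotProduct, smul_eq_mul, RingHom.id_apply]
        module } with hφ
  have := eq_zero_of_weightVec φ h.sign
    (fun l => by simp [hφ, h.pos_pos, h.dot_pos_pos])
    (fun l => by
      simp only [hφ, LinearMap.coe_mk, AddHom.coe_mk, h.neg_pos, h.dot_neg_pos]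
      split_ifs
      · module
      · simp)
    (fun hn => by simp [hφ, h.last_pos hn, lastVec_dotProduct hn]) a
  exact sub_eq_zero.1 this

theorem cquad_eq (a b : Fin n → ℂ) :
    ρ.cquad a b v =
      (1 / 2 : ℂ) • ∑ l,
        (ρ.cact a (weightVec n l (σ l)) (ρ.cact (weightVec n l (-σ l)) b v) +
          ρ.cact a (weightVec n l (-σ l)) (ρ.cact (weightVec n l (σ l)) b v)) +
      if Odd n then ρ.cact a (lastVec n) (ρ.cact (lastVec n) b v) else 0 :=
  ρ.cquad_apply_eq h.sign a b v

/-- Only the summand `l = i` survives and it acts as `k R(a, u_i)`, so the entry is `k² - s k + p`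
times a scalar product; the value of `p` makes `k` a root. -/
theorem cpoly_pos (a : Fin n → ℂ) (i : Fin (n / 2)) {s p : ℂ} (hp : p = -(k * (k - s))) :
    ρ.cpoly s p a (weightVec n i (σ i)) v = 0 := by
  rw [cpoly, LinearMap.add_apply, LinearMap.sub_apply, LinearMap.smul_apply, LinearMap.smul_apply,
    Module.End.one_apply, h.cquad_eq]
  have h1 : ∀ l, ρ.cact a (weightVec n l (σ l))
        (ρ.cact (weightVec n l (-σ l)) (weightVec n i (σ i)) v) +
      ρ.cact a (weightVec n l (-σ l)) (ρ.cact (weightVec n l (σ l)) (weightVec n i (σ i)) v) =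
      if l = i then (2 * k : ℂ) • ρ.cact a (weightVec n i (σ i)) v else 0 := by
    intro l
    rw [h.pos_pos, h.neg_pos, map_zero, add_zero, map_smul]
    split_ifs with hl
    · rw [hl]
    · rw [zero_smul]
  have h2 : (if Odd n then ρ.cact a (lastVec n) (ρ.cact (lastVec n) (weightVec n i (σ i)) v)
      else 0) = 0 := by
    split_ifs with hn
    · rw [h.last_pos hn, map_zero]
    · rfl
  rw [Finset.sum_congr rfl fun l _ => h1 l, h2, Finset.sum_ite_eq', if_pos (Finset.mem_univ i),
    h.cact_pos, hp]
  module

/-- The contributions of `k` from `l = i` and `l = j` cancel, leaving a multiple that depends only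
on `⌊n/2⌋`. -/
theorem cpoly_neg_neg_aux (i j : Fin (n / 2)) :
    (1 / 2 : ℂ) • ∑ l,
        (ρ.cact (weightVec n i (-σ i)) (weightVec n l (σ l))
            (ρ.cact (weightVec n l (-σ l)) (weightVec n j (-σ j)) v) +
          ρ.cact (weightVec n i (-σ i)) (weightVec n l (-σ l))
            (ρ.cact (weightVec n l (σ l)) (weightVec n j (-σ j)) v)) =
      (1 - (n / 2 : ℕ) : ℂ) • ρ.cact (weightVec n i (-σ i)) (weightVec n j (-σ j)) v := by
  have h1 : ∀ l, ρ.cact (weightVec n i (-σ i)) (weightVec n l (σ l))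
            (ρ.cact (weightVec n l (-σ l)) (weightVec n j (-σ j)) v) +
          ρ.cact (weightVec n i (-σ i)) (weightVec n l (-σ l))
            (ρ.cact (weightVec n l (σ l)) (weightVec n j (-σ j)) v) =
      (if l = i then (2 * k : ℂ) else 0) • ρ.cact (weightVec n i (-σ i)) (weightVec n j (-σ j)) v
      - (2 : ℂ) • ρ.cact (weightVec n i (-σ i)) (weightVec n j (-σ j)) v
      + (if l = j then (2 - 2 * k : ℂ) else 0) •
        ρ.cact (weightVec n i (-σ i)) (weightVec n j (-σ j)) v := by
    intro l
    rw [h.pos_neg, cact_cact_comm, h.neg_pos, h.dot_neg_neg, h.dot_neg_neg, h.dot_pos_neg,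
      h.dot_pos_neg, if_pos rfl, ρ.cact_swap (weightVec n l (-σ l)) (weightVec n i (-σ i)),
      LinearMap.neg_apply, map_smul, map_smul]
    by_cases hi : l = i
    · subst hi
      simp only [if_true]
      by_cases hj : l = j
      · subst hj
        simp only [if_true, cact_self, LinearMap.zero_apply]
        module
      · simp only [if_neg hj]
        module
    · simp only [if_neg hi, if_neg (Ne.symm hi)]
      by_cases hj : l = j
      · subst hj
        simp only [if_true]
        module
      · simp only [if_neg hj]
        module
  rw [Finset.sum_congr rfl fun l _ => h1 l, Finset.sum_add_distrib, Finset.sum_sub_distrib,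
    ← Finset.sum_smul, ← Finset.sum_smul, ← Finset.sum_smul, Finset.sum_ite_eq',
    Finset.sum_ite_eq', if_pos (Finset.mem_univ _), if_pos (Finset.mem_univ _)]
  simp only [Finset.sum_const, Finset.card_univ, Fintype.card_fin]
  module

/-- For the short root `ε_i` the vector `v` has coroot eigenvalue `2k = 1`, so it generates a
two-dimensional representation of the corresponding `𝔰𝔩₂` and lowering twice gives zero. Concretely,
the adjoint of `N` kills `N (N v)`, so this vector has norm zero. -/
theorem neg_last_sq (hn : Odd n) (i : Fin (n / 2)) :
    ρ.cact (weightVec n i (-σ i)) (lastVec n)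
      (ρ.cact (weightVec n i (-σ i)) (lastVec n) v) = 0 := by
  set N := ρ.cact (weightVec n i (-σ i)) (lastVec n) with hN
  have hk : (k : ℂ) = 1 / 2 := by rw [h.eq_half hn]; norm_num
  have h1 : ρ.cact (weightVec n i (σ i)) (lastVec n) (N v) = -v := by
    rw [hN, cact_cact_comm, h.pos_last hn, cact_self, h.neg_pos, dotProduct_lastVec hn,
      lastVec_dotProduct hn, lastVec_dotProduct_self hn.pos, if_pos rfl, hk]
    simp only [map_zero, LinearMap.zero_apply, smul_zero, zero_smul]
    module
  have h2 : ρ.cact (weightVec n i (-σ i)) (weightVec n i (σ i)) (N v) = -N v := by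
    rw [hN, cact_cact_comm, h.neg_pos, h.dot_neg_neg, h.dot_pos_neg,
      dotProduct_lastVec hn, dotProduct_lastVec hn, if_pos rfl, if_pos rfl, hk, map_smul]
    module
  have h3 : ρ.cact (weightVec n i (σ i)) (lastVec n) (N (N v)) = 0 := by
    rw [hN, cact_cact_comm, ← hN, h1, h2, cact_self, h.dot_pos_neg, dotProduct_lastVec hn,
      lastVec_dotProduct hn, lastVec_dotProduct_self hn.pos, if_pos rfl, map_neg]
    simp only [LinearMap.zero_apply, smul_zero, zero_smul]
    module
  have h4 : inner ℝ (N (N v)) (N (N v)) = (0 : ℝ) := by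
    conv_lhs => rw [hN, inner_cact, star_weightVec, star_lastVec, neg_neg, ← hN, h3]
    simp
  exact inner_self_eq_zero.1 h4

/-- This polarizes `neg_last_sq`: the Levi operator `R(u_j^-, u_i^+)` kills `v` and turns one factor
of index `i` into `-2` times the one of index `j`. -/
theorem neg_last_anticomm (hn : Odd n) (i j : Fin (n / 2)) :
    ρ.cact (weightVec n i (-σ i)) (lastVec n) (ρ.cact (weightVec n j (-σ j)) (lastVec n) v) +
      ρ.cact (weightVec n j (-σ j)) (lastVec n)
        (ρ.cact (weightVec n i (-σ i)) (lastVec n) v) = 0 := by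
  by_cases hij : i = j
  · subst hij
    rw [h.neg_last_sq hn, add_zero]
  · have h1 : ∀ w, ρ.cact (weightVec n j (-σ j)) (weightVec n i (σ i))
        (ρ.cact (weightVec n i (-σ i)) (lastVec n) w) =
        ρ.cact (weightVec n i (-σ i)) (lastVec n)
          (ρ.cact (weightVec n j (-σ j)) (weightVec n i (σ i)) w) -
        (2 : ℂ) • ρ.cact (weightVec n j (-σ j)) (lastVec n) w := by
      intro w
      rw [cact_cact_comm, h.dot_neg_neg, h.dot_pos_neg, dotProduct_lastVec hn,
        dotProduct_lastVec hn, if_pos rfl]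
      module
    have h2 := congrArg (ρ.cact (weightVec n j (-σ j)) (weightVec n i (σ i)))
      (h.neg_last_sq hn i)
    rw [h1, h1, h.neg_pos, if_neg (Ne.symm hij), zero_smul, map_zero, map_zero, zero_sub,
      map_neg, map_smul] at h2
    have h3 : (2 : ℂ) ≠ 0 := two_ne_zero
    refine (smul_eq_zero.1 (Eq.trans ?_ h2 : (-2 : ℂ) • (_ : ℂ ⊗[ℝ] V) = 0)).resolve_left
      (neg_ne_zero.2 h3)
    module

theorem cpoly_neg_neg (i j : Fin (n / 2)) {s : ℂ} (hs : s = 1 - n / 2) (p : ℂ) :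
    ρ.cpoly s p (weightVec n i (-σ i)) (weightVec n j (-σ j)) v = 0 := by
  rw [cpoly, LinearMap.add_apply, LinearMap.sub_apply, LinearMap.smul_apply, LinearMap.smul_apply,
    Module.End.one_apply, h.cquad_eq, h.cpoly_neg_neg_aux, h.dot_neg_neg]
  by_cases hn : Odd n
  · have h1 := h.neg_last_anticomm hn i j
    -- The commutator of the two factors is `R(u_i^-, u_j^-)` and their anticommutator vanishes on
    -- `v`, so their product is half of it. This supplies the missing `-1/2` in `1 - n/2 = 1 - ⌊n/2⌋
    -- - 1/2`.
    have h2 := ρ.cact_cact_comm (weightVec n i (-σ i)) (lastVec n) (weightVec n j (-σ j))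
      (lastVec n) v
    rw [h.dot_neg_neg, dotProduct_lastVec hn, lastVec_dotProduct hn,
      lastVec_dotProduct_self hn.pos, cact_self, ρ.cact_swap (weightVec n j _) (weightVec n i _),
      LinearMap.neg_apply, LinearMap.zero_apply] at h2
    rw [if_pos hn, ρ.cact_swap (lastVec n), LinearMap.neg_apply, map_neg, hs, natCast_eq_of_odd hn]
    linear_combination (norm := module) (-1 / 2 : ℂ) • h1 - (1 / 2 : ℂ) • h2
  · have hn' : (2 : ℂ) * (n / 2 : ℕ) = n := by
      exact_mod_cast Nat.two_mul_div_two_of_even (Nat.not_odd_iff_even.1 hn)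
    have hn'' : (n : ℂ) / 2 = (n / 2 : ℕ) := by rw [← hn', mul_div_cancel_left₀ _ two_ne_zero]
    rw [if_neg hn, hs, hn'']
    module

theorem cpoly_last_neg (hn : Odd n) (j : Fin (n / 2)) {s : ℂ} (hs : s = 1 - n / 2) (p : ℂ) :
    ρ.cpoly s p (lastVec n) (weightVec n j (-σ j)) v = 0 := by
  have hk : (k : ℂ) = 1 / 2 := by rw [h.eq_half hn]; norm_num
  have h1 : ∀ l, ρ.cact (lastVec n) (weightVec n l (σ l))
        (ρ.cact (weightVec n l (-σ l)) (weightVec n j (-σ j)) v) +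
      ρ.cact (lastVec n) (weightVec n l (-σ l))
        (ρ.cact (weightVec n l (σ l)) (weightVec n j (-σ j)) v) =
      (if l = j then (1 : ℂ) else 0) • ρ.cact (lastVec n) (weightVec n j (-σ j)) v -
      (2 : ℂ) • ρ.cact (lastVec n) (weightVec n j (-σ j)) v := by
    intro l
    rw [h.pos_neg, cact_cact_comm, h.last_pos hn, h.dot_pos_neg, h.dot_pos_neg,
      lastVec_dotProduct hn, lastVec_dotProduct hn, if_pos rfl,
      ρ.cact_swap (weightVec n l (-σ l)) (lastVec n), LinearMap.neg_apply, map_smul, map_zero, hk]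
    by_cases hj : l = j
    · subst hj
      simp only [if_true]
      module
    · simp only [if_neg hj]
      module
  rw [cpoly, LinearMap.add_apply, LinearMap.sub_apply, LinearMap.smul_apply, LinearMap.smul_apply,
    Module.End.one_apply, h.cquad_eq, Finset.sum_congr rfl fun l _ => h1 l,
    Finset.sum_sub_distrib, ← Finset.sum_smul, Finset.sum_ite_eq', if_pos (Finset.mem_univ _),
    if_pos hn, cact_self, lastVec_dotProduct hn, hs, natCast_eq_of_odd hn]
  simp only [Finset.sum_const, Finset.card_univ, Fintype.card_fin, LinearMap.zero_apply]
  module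

theorem cpoly_last_last (hn : Odd n) {s p : ℂ} (hs : s = 1 - n / 2) (hp : p = -(k * (k - s))) :
    ρ.cpoly s p (lastVec n) (lastVec n) v = 0 := by
  have hk : (k : ℂ) = 1 / 2 := by rw [h.eq_half hn]; norm_num
  have h1 : ∀ l, ρ.cact (lastVec n) (weightVec n l (σ l))
        (ρ.cact (weightVec n l (-σ l)) (lastVec n) v) +
      ρ.cact (lastVec n) (weightVec n l (-σ l))
        (ρ.cact (weightVec n l (σ l)) (lastVec n) v) = v := by
    intro l
    rw [h.pos_last hn, cact_cact_comm, h.last_pos hn, cact_self, h.neg_pos, h.dot_pos_neg,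
      dotProduct_lastVec hn, lastVec_dotProduct hn, lastVec_dotProduct_self hn.pos, if_pos rfl, hk]
    simp only [map_zero, LinearMap.zero_apply, smul_zero, if_true]
    module
  rw [cpoly, LinearMap.add_apply, LinearMap.sub_apply, LinearMap.smul_apply, LinearMap.smul_apply,
    Module.End.one_apply, h.cquad_eq, Finset.sum_congr rfl fun l _ => h1 l, if_pos hn, cact_self,
    lastVec_dotProduct_self hn.pos, hp, hs, hk, natCast_eq_of_odd hn]
  simp only [Finset.sum_const, Finset.card_univ, Fintype.card_fin, LinearMap.zero_apply]
  module

theorem cpoly_eq_zero (a b : Fin n → ℂ) {s p : ℂ} (hs : s = 1 - n / 2)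
    (hp : p = -(k * (k - s))) : ρ.cpoly s p a b v = 0 := by
  have hlin : ∀ b, ∃ φ : (Fin n → ℂ) →ₗ[ℂ] ℂ ⊗[ℝ] V, ∀ a, φ a = ρ.cpoly s p a b v := by
    intro b
    refine ⟨{ toFun := fun a => ρ.cpoly s p a b v, map_add' := fun a a' => ?_,
              map_smul' := fun c a => ?_ }, fun a => rfl⟩
    · simp only [cpoly, map_add, LinearMap.add_apply, LinearMap.sub_apply, LinearMap.smul_apply,
        add_dotProduct, Module.End.one_apply]
      module
    · simp only [cpoly, map_smul, LinearMap.add_apply, LinearMap.sub_apply, LinearMap.smul_apply,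
        smul_dotProduct, Module.End.one_apply, RingHom.id_apply, smul_eq_mul]
      module
  have key : ∀ b, (∀ i, ρ.cpoly s p (weightVec n i (-σ i)) b v = 0) →
      (Odd n → ρ.cpoly s p (lastVec n) b v = 0) → ∀ a, ρ.cpoly s p a b v = 0 := by
    intro b h1 h2 a
    obtain ⟨φ, hφ⟩ := hlin b
    rw [← hφ]
    refine eq_zero_of_weightVec φ h.sign (fun l => ?_) (fun l => ?_) (fun hn => ?_) a
    · rw [hφ, cpoly_swap _ hs, h.cpoly_pos _ _ hp]
    · rw [hφ, h1]
    · rw [hφ, h2 hn]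
  refine key b (fun i => ?_) (fun hn => ?_) a
  · rw [cpoly_swap _ hs]
    exact key _ (fun j => h.cpoly_neg_neg _ _ hs _) (fun hn => h.cpoly_last_neg hn _ hs _) _
  · rw [cpoly_swap _ hs]
    refine key _ (fun j => ?_) (fun hn => h.cpoly_last_last hn hs hp) _
    rw [cpoly_swap _ hs, h.cpoly_last_neg hn _ hs]

end IsPureVector

theorem IsHighestWeightVector.eq_zero_of_add_eq_zero {lam : Fin (n / 2) → ℝ} {v : ℂ ⊗[ℝ] V}
    (h : ρ.IsHighestWeightVector lam v) {l i : Fin (n / 2)} (hli : l < i) {s : ℝ}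
    (hs : s * s = 1) (h0 : lam l + s * lam i = 0) :
    ρ.cact (weightVec n l (-1)) (weightVec n i (-s)) v = 0 := by
  have := h.norm_sq_neg hli hs
  rw [h0, mul_zero, zero_mul] at this
  exact norm_eq_zero.1 (pow_eq_zero_iff two_ne_zero |>.1 this)

theorem IsHighestWeightVector.isPureVector {lam : Fin (n / 2) → ℝ} {v : ℂ ⊗[ℝ] V}
    (h : ρ.IsHighestWeightVector lam v) {k : ℝ}
    (hlam : IsHalfSpinPowerWeight n lam k ∨ IsSpinWeight n lam k) :
    ∃ σ, ρ.IsPureVector σ k v := by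
  -- The sign is chosen so that `lam i = k * σ i`; it can be `-1` only at the last place.
  set σ : Fin (n / 2) → ℝ := fun i => if lam i = k then 1 else -1 with hσ
  have h1 : ∀ i, σ i * σ i = 1 := fun i => by
    simp only [hσ]
    split_ifs <;> norm_num
  have h2 : ∀ i, lam i = k * σ i := by
    intro i
    simp only [hσ]
    split_ifs with hi
    · rw [hi, mul_one]
    · rcases hlam with ⟨-, -, hl⟩ | ⟨-, -, hl⟩
      · rcases Nat.lt_or_ge ((i : ℕ) + 1) (n / 2) with h3 | h3
        · exact absurd ((hl i).1 h3) hi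
        · have := ((hl i).2 (by have := i.2; omega)).resolve_left hi
          rw [this]
          ring
      · exact absurd (hl i) hi
  have h3 : ∀ i j : Fin (n / 2), i < j → σ i = 1 := by
    intro i j hij
    refine if_pos ?_
    rcases hlam with ⟨-, -, hl⟩ | ⟨-, -, hl⟩
    · exact (hl i).1 (by have := j.2; have : (i : ℕ) < j := hij; omega)
    · exact hl i
  refine ⟨σ, h1, fun l i => ?_, fun l i => ?_, fun hn i => ?_, fun hn => ?_⟩
  · rcases lt_trichotomy l i with hl | hl | hl
    · rw [h3 l i hl, h.pos _ _ hl _ (h1 i)]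
    · rw [hl, cact_self, LinearMap.zero_apply]
    · rw [h3 i l hl, h.pos' hl (h1 l)]
  · rcases lt_trichotomy l i with hl | hl | hl
    · rw [h3 l i hl, if_neg hl.ne, zero_smul]
      -- This root vector lowers, but its coroot pairs to zero with `lam`, since `lam l = σ i * lam
      -- i = k`; hence it kills `v` as well.
      have := h.eq_zero_of_add_eq_zero hl (s := -σ i) (by rw [neg_mul_neg, h1]) (by
        rw [h2 l, h2 i, h3 l i hl]
        linear_combination -k * h1 i)
      rwa [neg_neg] at this
    · subst hl
      rw [h.weight, if_pos rfl, h2 l]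
      congr 1
      have : (σ l : ℂ) * σ l = 1 := by exact_mod_cast h1 l
      push_cast
      linear_combination 2 * k * this
    · rw [h3 i l hl, if_neg hl.ne', zero_smul, h.pos' hl (by rw [neg_mul_neg, h1])]
  · have : σ i = 1 := by
      rcases hlam with ⟨he, -, -⟩ | ⟨-, -, hl⟩
      · exact absurd hn (Nat.not_odd_iff_even.2 he)
      · exact if_pos (hl i)
    rw [this, h.pos_last' hn]
  · rcases hlam with ⟨he, -, -⟩ | ⟨-, hl, -⟩
    · exact absurd hn (Nat.not_odd_iff_even.2 he)
    · exact hl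

end OrthRep

end Kato

namespace Kato

namespace OrthRep

open Matrix

/-! ### Invariance of the quadratic relation -/

variable {n : ℕ} {V : Type*} [NormedAddCommGroup V] [InnerProductSpace ℝ V] (ρ : OrthRep n V)

theorem act_mul_act_wedge (A : soAlg n) (i j : Fin n) :
    ρ.act A * ρ.act (wedge (e i) (e j)) =
      ρ.act (wedge (e i) (e j)) * ρ.act A +
      ∑ l, ((A : Matrix (Fin n) (Fin n) ℝ) l i • ρ.act (wedge (e l) (e j)) +
        (A : Matrix (Fin n) (Fin n) ℝ) l j • ρ.act (wedge (e i) (e l))) := by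
  have := congrArg ρ.act (lie_wedge_e A i j)
  rw [LieHom.map_lie, Ring.lie_def, map_sum] at this
  simp only [map_add, map_smul] at this
  rw [← this]
  abel

theorem soAlg_apply_swap (A : soAlg n) (i j : Fin n) :
    (A : Matrix (Fin n) (Fin n) ℝ) i j = -(A : Matrix (Fin n) (Fin n) ℝ) j i := by
  have hA : (A : Matrix (Fin n) (Fin n) ℝ)ᵀ = -A := (LieAlgebra.Orthogonal.mem_so _ _ _).1 A.2
  exact congrFun (congrFun hA j) i

/-- The entries transform like a tensor with two indices: `B` is equivariant and so is any
polynomial in it. -/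
theorem act_mul_quad (s p : ℝ) (A : soAlg n) (i j : Fin n) :
    ρ.act A * ρ.quad s p i j =
      ρ.quad s p i j * ρ.act A +
      ∑ l, ((A : Matrix (Fin n) (Fin n) ℝ) l i • ρ.quad s p l j +
        (A : Matrix (Fin n) (Fin n) ℝ) l j • ρ.quad s p i l) := by
  set X : Fin n → Fin n → Module.End ℝ V := fun i j => ρ.act (wedge (e i) (e j)) with hX
  set a := ρ.act A with ha
  set M : Matrix (Fin n) (Fin n) ℝ := (A : Matrix (Fin n) (Fin n) ℝ) with hM
  have hMs : ∀ i j, M i j = -M j i := soAlg_apply_swap A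
  have h1 : ∀ i j, a * X i j = X i j * a + ∑ l, (M l i • X l j + M l j • X i l) :=
    ρ.act_mul_act_wedge A
  have hq : ∀ i j, ρ.quad s p i j =
      ∑ k, X i k * X k j - s • X i j + (if i = j then p else 0) • 1 := fun i j => rfl
  have h2 : ∀ k, a * (X i k * X k j) = X i k * X k j * a +
      (∑ l, M l i • (X l k * X k j) + ∑ l, M l k • (X i l * X k j) +
        (∑ l, M l k • (X i k * X l j) + ∑ l, M l j • (X i k * X k l))) := by
    intro k
    rw [← mul_assoc, h1, add_mul, mul_assoc, h1, mul_add, ← mul_assoc, Finset.sum_add_distrib,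
      Finset.sum_add_distrib, add_mul, mul_add, Finset.sum_mul, Finset.sum_mul, Finset.mul_sum,
      Finset.mul_sum]
    simp only [smul_mul_assoc, mul_smul_comm]
    abel
  -- Terms hitting the contracted index `k` cancel because `M` is skew.
  have h3 : ∑ k, ∑ l, M l k • (X i k * X l j) = -∑ k, ∑ l, M l k • (X i l * X k j) := by
    rw [Finset.sum_comm, ← Finset.sum_neg_distrib]
    refine Finset.sum_congr rfl fun k _ => ?_
    rw [← Finset.sum_neg_distrib]
    refine Finset.sum_congr rfl fun l _ => ?_
    rw [hMs k l, neg_smul]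
  have h4 : ∑ l, (M l i • ((if l = j then p else 0) • (1 : Module.End ℝ V)) +
      M l j • ((if i = l then p else 0) • (1 : Module.End ℝ V))) = 0 := by
    simp only [ite_smul, zero_smul, smul_ite, smul_zero, Finset.sum_add_distrib,
      Finset.sum_ite_eq, Finset.sum_ite_eq', Finset.mem_univ, if_true]
    rw [hMs j i, neg_smul, neg_add_cancel]
  simp only [hq, mul_add, mul_sub, add_mul, sub_mul, smul_add, smul_sub, Finset.mul_sum,
    Finset.sum_mul, Finset.smul_sum, h2, Finset.sum_add_distrib, Finset.sum_sub_distrib, h3,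
    mul_smul_comm, smul_mul_assoc, mul_one, one_mul, h1] at h4 ⊢
  rw [Finset.sum_comm (f := fun k l => M l i • (X l k * X k j)),
    Finset.sum_comm (f := fun k l => M l j • (X i k * X k l))]
  simp only [smul_comm s]
  rw [← sub_eq_zero, ← neg_eq_zero, ← h4]
  abel

theorem quad_comm_of_comm (s p : ℝ) {J : V → V} (hJ : ∀ A v, J (ρ.act A v) = ρ.act A (J v))
    (hadd : ∀ v w, J (v + w) = J v + J w) (hsmul : ∀ (c : ℝ) v, J (c • v) = c • J v)
    (i j : Fin n) (v : V) : J (ρ.quad s p i j v) = ρ.quad s p i j (J v) := by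
  set J' : V →ₗ[ℝ] V := ⟨⟨J, hadd⟩, hsmul⟩ with hJ'
  change J' _ = ρ.quad s p i j (J' v)
  have h : ∀ A v, J' (ρ.act A v) = ρ.act A (J' v) := hJ
  simp only [quad, LinearMap.add_apply, LinearMap.sub_apply, LinearMap.smul_apply,
    LinearMap.sum_apply, Module.End.mul_apply, Module.End.one_apply, map_add, map_sub, map_smul,
    map_sum, h]

/-- The subspace on which the quadratic relation holds. -/
noncomputable def quadKer (s p : ℝ) : Submodule ℝ V :=
  ⨅ i, ⨅ j, LinearMap.ker (ρ.quad s p i j)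

theorem mem_quadKer {s p : ℝ} {v : V} : v ∈ ρ.quadKer s p ↔ ∀ i j, ρ.quad s p i j v = 0 := by
  simp [quadKer, Submodule.mem_iInf]

theorem act_mem_quadKer {s p : ℝ} (A : soAlg n) {v : V} (hv : v ∈ ρ.quadKer s p) :
    ρ.act A v ∈ ρ.quadKer s p := by
  rw [mem_quadKer] at hv ⊢
  intro i j
  have := LinearMap.congr_fun (ρ.act_mul_quad s p A i j) v
  simp only [Module.End.mul_apply, LinearMap.add_apply, LinearMap.sum_apply,
    LinearMap.smul_apply, hv, map_zero, smul_zero, add_zero, Finset.sum_const_zero] at this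
  exact this.symm

variable {ρ}

theorem IsIrreducible.nontrivial (hρ : ρ.IsIrreducible) : Nontrivial V := by
  rcases hρ with h | h <;> exact h.1

/-- `quadKer` is invariant and nonzero. In the complex case it is also stable under `J`, as `J`
commutes with every entry. -/
theorem IsIrreducible.quad_eq_zero (hρ : ρ.IsIrreducible) {s p : ℝ} {v : V} (hv : v ≠ 0)
    (h : ∀ i j, ρ.quad s p i j v = 0) (i j : Fin n) : ρ.quad s p i j = 0 := by
  have htop : ρ.quadKer s p = ⊤ := by
    have hne : ρ.quadKer s p ≠ ⊥ := fun hbot =>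
      hv ((Submodule.mem_bot ℝ).1 (hbot ▸ ρ.mem_quadKer.2 h))
    rcases hρ with ⟨-, hirr⟩ | ⟨-, J, -, hcomm, hirr⟩
    · exact (hirr _ fun A w hw => ρ.act_mem_quadKer A hw).resolve_left hne
    · refine (hirr _ (fun A w hw => ρ.act_mem_quadKer A hw) fun w hw => ?_).resolve_left hne
      rw [mem_quadKer] at hw ⊢
      intro i j
      rw [← ρ.quad_comm_of_comm s p hcomm (map_add J) (map_smul J), hw, map_zero]
  ext w
  exact ρ.mem_quadKer.1 (htop ▸ Submodule.mem_top : w ∈ ρ.quadKer s p) i j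

theorem IsIrreducible.quad_eq_zero_of_weight (hρ : ρ.IsIrreducible) {lam : Fin (n / 2) → ℝ}
    (hlam : ρ.IsHighestWeight lam) {k : ℝ}
    (hk : IsHalfSpinPowerWeight n lam k ∨ IsSpinWeight n lam k) (i j : Fin n) :
    ρ.quad (1 - n / 2) (-(k * (k - (1 - n / 2)))) i j = 0 := by
  obtain ⟨v, hv⟩ := hlam.exists_vector
  obtain ⟨σ, hσ⟩ := hv.isPureVector hk
  obtain ⟨w, hw, hq⟩ := exists_ne_zero_of_baseChange
    (fun q : Fin n × Fin n => ρ.quad (1 - n / 2) (-(k * (k - (1 - n / 2)))) q.1 q.2)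
    hv.ne_zero (fun q => by
      rw [← cpoly_single]
      exact hσ.cpoly_eq_zero _ _ (by push_cast; ring) (by push_cast; ring))
  exact hρ.quad_eq_zero hw (fun i j => hq (i, j)) i j

variable (ρ)

/-! ### The operator `B` -/

theorem _root_.Kato.inner_e_left {n : ℕ} (i : Fin n) (β : Rn n) : inner ℝ (e i) β = β i := by
  rw [EuclideanSpace.inner_single_left]
  simp

theorem B_e_tmul (j : Fin n) (v : V) :
    ρ.B (e j ⊗ₜ v) = ∑ i, e i ⊗ₜ[ℝ] ρ.act (wedge (e i) (e j)) v := ρ.B_tmul _ _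

theorem B_quad_e_tmul (s p : ℝ) (j : Fin n) (v : V) :
    (ρ.B * ρ.B - s • ρ.B + p • 1) (e j ⊗ₜ v) = ∑ i, e i ⊗ₜ[ℝ] ρ.quad s p i j v := by
  simp only [LinearMap.add_apply, LinearMap.sub_apply, LinearMap.smul_apply, Module.End.mul_apply,
    Module.End.one_apply, B_e_tmul, map_sum, quad, LinearMap.sum_apply, TensorProduct.tmul_add,
    TensorProduct.tmul_sub, TensorProduct.tmul_sum, TensorProduct.tmul_smul,
    Finset.sum_add_distrib, Finset.sum_sub_distrib, Finset.smul_sum]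
  congr 1
  · rw [Finset.sum_comm]
  · simp

theorem inner_sum_e_tmul (u : Fin n → V) (i : Fin n) (w : V) :
    inner ℝ (∑ i, (e i : Rn n) ⊗ₜ[ℝ] u i) ((e i : Rn n) ⊗ₜ[ℝ] w) = inner ℝ (u i) w := by
  rw [sum_inner, Finset.sum_eq_single i]
  · simp
  · intro j _ hj
    rw [TensorProduct.inner_tmul, inner_e_left]
    simp [hj]
  · simp

theorem tensor_ext {W : Type*} [AddCommGroup W] [Module ℝ W] {f g : Rn n ⊗[ℝ] V →ₗ[ℝ] W}
    (h : ∀ j v, f (e j ⊗ₜ v) = g (e j ⊗ₜ v)) : f = g := by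
  refine TensorProduct.ext ((EuclideanSpace.basisFun (Fin n) ℝ).toBasis.ext fun j => ?_)
  ext v
  simpa using h j v

theorem B_quad_eq_zero_iff (s p : ℝ) :
    ρ.B * ρ.B - s • ρ.B + p • 1 = 0 ↔ ∀ i j, ρ.quad s p i j = 0 := by
  constructor
  · intro h i j
    ext v
    refine ext_inner_right ℝ fun w => ?_
    rw [← inner_sum_e_tmul (fun i => ρ.quad s p i j v), ← B_quad_e_tmul, h]
    simp
  · intro h
    refine tensor_ext fun j v => ?_
    rw [B_quad_e_tmul]
    simp [h]

theorem inner_B_tmul (α β : Rn n) (v w : V) :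
    inner ℝ (ρ.B (α ⊗ₜ v)) (β ⊗ₜ w) = inner ℝ (ρ.act (wedge β α) v) w := by
  have hβ : wedge β α = ∑ i, β i • wedge (e i) α := by
    have h1 : β = ∑ i, β i • e i := by
      ext p
      simp [e, Finset.sum_apply, Pi.single_apply]
    have h2 := map_sum (IsLinearMap.mk' (wedge α) ⟨wedge_add α, fun r a => wedge_smul r α a⟩)
      (fun l => β l • (e l : Rn n)) Finset.univ
    simp only [map_smul, IsLinearMap.mk'_apply] at h2
    rw [wedge_swap]
    nth_rewrite 1 [h1]
    rw [h2, ← Finset.sum_neg_distrib]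
    refine Finset.sum_congr rfl fun i _ => ?_
    rw [wedge_swap α, smul_neg, neg_neg]
  rw [B_tmul, sum_inner, hβ, map_sum, LinearMap.sum_apply, sum_inner]
  refine Finset.sum_congr rfl fun i _ => ?_
  rw [TensorProduct.inner_tmul, map_smul, LinearMap.smul_apply, inner_smul_left, inner_e_left]
  simp

/-- This is skewness of the action of `wedge β α`. It drives both the occurrence of two eigenvalues
and the constant in the Kato inequality. -/
theorem inner_B_tmul_self (α β : Rn n) (v : V) :
    inner ℝ (ρ.B (α ⊗ₜ v)) (β ⊗ₜ v) = 0 := by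
  rw [inner_B_tmul]
  have := ρ.skew (wedge β α) v v
  have h := real_inner_comm v (ρ.act (wedge β α) v)
  linarith

theorem B_isSymmetric : ρ.B.IsSymmetric := by
  intro x y
  induction x with
  | zero => simp
  | add x x' hx hx' => rw [map_add, inner_add_left, inner_add_left, hx, hx']
  | tmul α v =>
    induction y with
    | zero => simp
    | add y y' hy hy' => rw [map_add, inner_add_right, inner_add_right, hy, hy']
    | tmul β w =>
      rw [inner_B_tmul, real_inner_comm _ (α ⊗ₜ[ℝ] v), inner_B_tmul, ρ.skew, wedge_swap α β,
        map_neg, LinearMap.neg_apply, inner_neg_left, real_inner_comm]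

end OrthRep

end Kato

namespace Kato

namespace OrthRep

/-! ### Representations with two conformal weights -/

variable {n : ℕ} {V : Type*} [NormedAddCommGroup V] [InnerProductSpace ℝ V] (ρ : OrthRep n V)

theorem B_eq_zero_of_act (h : ∀ i j : Fin n, ρ.act (wedge (e i) (e j)) = 0) : ρ.B = 0 := by
  refine tensor_ext fun j v => ?_
  rw [B_e_tmul]
  simp [h]

theorem B_eq_zero_of_cact (h : ∀ a b, ρ.cact a b = 0) : ρ.B = 0 := by
  refine ρ.B_eq_zero_of_act fun i j => ?_
  ext v
  have h1 := LinearMap.congr_fun (h (Pi.single i 1) (Pi.single j 1)) ((1 : ℂ) ⊗ₜ[ℝ] v)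
  rw [cact_single, LinearMap.baseChange_tmul, LinearMap.zero_apply] at h1
  simpa using congrArg (rePart V) h1

/-- The antisymmetric part of the relation is `(2 - n - 2s) R = 0`, and `R` is not zero. -/
theorem sum_eq_of_quad {s p : ℝ} (hB : ρ.B ≠ 0) (h : ∀ i j, ρ.quad s p i j = 0) :
    s = 1 - n / 2 := by
  by_contra hs
  refine hB (ρ.B_eq_zero_of_cact fun a b => ?_)
  have h1 := ρ.cpoly_eq_zero h a b
  have h2 := ρ.cpoly_eq_zero h b a
  have h3 := ρ.cquad_sub_swap a b
  rw [cpoly] at h1 h2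
  rw [dotProduct_comm b a, ρ.cact_swap b a] at h2
  have h4 : (2 - n - 2 * s : ℂ) • ρ.cact a b = 0 := by
    linear_combination (norm := module) h1 - h2 - h3
  refine (smul_eq_zero.1 h4).resolve_left fun h5 => hs ?_
  have h6 : (2 - n - 2 * s : ℝ) = 0 := by exact_mod_cast h5
  linarith

/-- A diagonal entry paired with `v` reads `∑ ‖X_{ki} v‖² = -p ‖v‖²`, so `p ≤ 0`, and `p = 0` would
make every `X_{ki}` vanish. -/
theorem prod_neg_of_quad [Nontrivial V] (hn : 0 < n) {s p : ℝ} (hB : ρ.B ≠ 0)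
    (h : ∀ i j, ρ.quad s p i j = 0) : p < 0 := by
  have key : ∀ (i : Fin n) (v : V),
      ∑ k, ‖ρ.act (wedge (e k) (e i)) v‖ ^ 2 = -p * ‖v‖ ^ 2 := by
    intro i v
    have h1 : inner ℝ (ρ.quad s p i i v) v = (0 : ℝ) := by rw [h]; simp
    have h2 : ∀ k, inner ℝ (ρ.act (wedge (e i) (e k)) (ρ.act (wedge (e k) (e i)) v)) v =
        ‖ρ.act (wedge (e k) (e i)) v‖ ^ 2 := by
      intro k
      rw [ρ.skew, wedge_swap (e i) (e k), map_neg, LinearMap.neg_apply, inner_neg_right, neg_neg,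
        real_inner_self_eq_norm_sq]
    have h3 : ρ.act (wedge (e i) (e i)) = 0 := by
      have : wedge (e i : Rn n) (e i) = 0 := by
        ext
        simp [wedge]
      rw [this, map_zero]
    simp only [quad, LinearMap.add_apply, LinearMap.sub_apply, LinearMap.smul_apply,
      LinearMap.sum_apply, Module.End.mul_apply, Module.End.one_apply, inner_add_left,
      inner_sub_left, sum_inner, h2, h3, if_true, inner_smul_left, real_inner_self_eq_norm_sq,
      LinearMap.zero_apply, inner_zero_left] at h1
    simp at h1
    linarith
  obtain ⟨v, hv⟩ := exists_ne (0 : V)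
  have hv' : 0 < ‖v‖ ^ 2 := by have := norm_pos_iff.2 hv; positivity
  have hp : p ≤ 0 := by
    have h1 := key ⟨0, hn⟩ v
    have h2 : 0 ≤ ∑ k, ‖ρ.act (wedge (e k) (e ⟨0, hn⟩)) v‖ ^ 2 :=
      Finset.sum_nonneg fun k _ => sq_nonneg _
    by_contra hc
    push Not at hc
    nlinarith
  refine lt_of_le_of_ne hp fun h0 => hB (ρ.B_eq_zero_of_act fun k i => ?_)
  ext v
  have h1 := key i v
  rw [h0, neg_zero, zero_mul, Finset.sum_eq_zero_iff_of_nonneg fun k _ => sq_nonneg _] at h1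
  exact norm_eq_zero.1 (pow_eq_zero_iff two_ne_zero |>.1 (h1 k (Finset.mem_univ k)))

/-- `B` has exactly the two eigenvalues `w₁ > w₂`. -/
structure HasTwoWeights (w₁ w₂ : ℝ) : Prop where
  lt : w₂ < w₁
  mem : ∀ μ, Module.End.HasEigenvalue ρ.B μ ↔ μ = w₁ ∨ μ = w₂

variable {ρ}

theorem HasTwoWeights.B_ne_zero {w₁ w₂ : ℝ} (h : ρ.HasTwoWeights w₁ w₂) : ρ.B ≠ 0 := by
  intro h0
  have key : ∀ μ, Module.End.HasEigenvalue ρ.B μ → μ = 0 := by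
    intro μ hμ
    obtain ⟨x, hx⟩ := hμ.exists_hasEigenvector
    have := hx.apply_eq_smul
    rw [h0, LinearMap.zero_apply] at this
    exact (smul_eq_zero.1 this.symm).resolve_right hx.2
  have h1 := key w₁ ((h.mem _).2 (Or.inl rfl))
  have h2 := key w₂ ((h.mem _).2 (Or.inr rfl))
  exact h.lt.ne (h2.trans h1.symm)

theorem HasTwoWeights.unique {w₁ w₂ w₁' w₂' : ℝ} (h : ρ.HasTwoWeights w₁ w₂)
    (h' : ρ.HasTwoWeights w₁' w₂') : w₁ = w₁' ∧ w₂ = w₂' := by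
  have h1 := (h'.mem w₁).1 ((h.mem _).2 (Or.inl rfl))
  have h2 := (h'.mem w₂).1 ((h.mem _).2 (Or.inr rfl))
  have h3 := h.lt
  have h4 := h'.lt
  rcases h1 with h1 | h1 <;> rcases h2 with h2 | h2
  · exact absurd (h1.trans h2.symm) h3.ne'
  · exact ⟨h1, h2⟩
  · rw [h1, h2] at h3
    exact absurd h3 (lt_asymm h4)
  · exact absurd (h1.trans h2.symm) h3.ne'

variable (ρ)

variable [FiniteDimensional ℝ V]

theorem mem_confWeights {μ : ℝ} : μ ∈ ρ.confWeights ↔ Module.End.HasEigenvalue ρ.B μ := by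
  simp [confWeights]

theorem exists_hasTwoWeights (h : ρ.numWeights = 2) : ρ.HasTwoWeights (ρ.w 1) (ρ.w 2) := by
  set l := ρ.confWeights.sort (· ≥ ·) with hl
  have hlen : l.length = 2 := by rw [hl, Finset.length_sort]; exact h
  obtain ⟨a, b, hab⟩ := List.length_eq_two.1 hlen
  have hw1 : ρ.w 1 = a := by
    unfold w
    rw [← hl, hab]
    rfl
  have hw2 : ρ.w 2 = b := by
    unfold w
    rw [← hl, hab]
    rfl
  have hmem : ∀ μ, μ ∈ l ↔ μ ∈ ρ.confWeights := fun μ => Finset.mem_sort _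
  have hnd : l.Nodup := Finset.sort_nodup _ _
  have hs : l.Pairwise (· ≥ ·) := Finset.pairwise_sort _ _
  rw [hab] at hnd hs hmem
  rw [hw1, hw2]
  refine ⟨?_, fun μ => ?_⟩
  · have h1 : a ≠ b := by simpa using hnd
    have h2 : b ≤ a := by simpa using hs
    exact lt_of_le_of_ne h2 h1.symm
  · rw [← mem_confWeights, ← hmem]
    simp

variable {ρ}

theorem HasTwoWeights.numWeights_eq {w₁ w₂ : ℝ} (h : ρ.HasTwoWeights w₁ w₂) :
    ρ.numWeights = 2 := by
  have : ρ.confWeights = {w₁, w₂} := by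
    ext μ
    rw [mem_confWeights, h.mem]
    simp
  rw [numWeights, this, Finset.card_pair h.lt.ne']

/-- The eigenspaces of a symmetric operator span, and the relation holds on each of them. -/
theorem HasTwoWeights.relation {w₁ w₂ : ℝ} (h : ρ.HasTwoWeights w₁ w₂) :
    ρ.B * ρ.B - (w₁ + w₂) • ρ.B + (w₁ * w₂) • 1 = 0 := by
  have htop : (⨆ μ, Module.End.eigenspace ρ.B μ) = ⊤ := by
    have := ρ.B_isSymmetric.orthogonalComplement_iSup_eigenspaces_eq_bot
    exact Submodule.orthogonal_eq_bot_iff.1 this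
  rw [← LinearMap.ker_eq_top, eq_top_iff, ← htop, iSup_le_iff]
  intro μ x hx
  rw [Module.End.mem_eigenspace_iff] at hx
  rw [LinearMap.mem_ker]
  simp only [LinearMap.add_apply, LinearMap.sub_apply, LinearMap.smul_apply, Module.End.mul_apply,
    Module.End.one_apply, hx, map_smul]
  by_cases hx0 : x = 0
  · simp [hx0]
  · have hμ : Module.End.HasEigenvalue ρ.B μ :=
      Module.End.hasEigenvalue_of_hasEigenvector ⟨Module.End.mem_eigenspace_iff.2 hx, hx0⟩
    rcases (h.mem μ).1 hμ with rfl | rfl <;> module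

theorem HasTwoWeights.quad_eq_zero {w₁ w₂ : ℝ} (h : ρ.HasTwoWeights w₁ w₂) (i j : Fin n) :
    ρ.quad (w₁ + w₂) (w₁ * w₂) i j = 0 :=
  (ρ.B_quad_eq_zero_iff _ _).1 h.relation i j

omit [FiniteDimensional ℝ V] in
-- The relation allows no other eigenvalue. Both occur: for `y = e₀ ⊗ v` one has `⟨B y, y⟩ = 0`, so
-- `y` is not an eigenvector for a nonzero eigenvalue. Hence `B y - w₂ y` and `B y - w₁ y` are
-- nonzero, and the relation makes them eigenvectors for `w₁` and `w₂`.
theorem hasTwoWeights_of_quad [Nontrivial V] (hn : 0 < n) {w₁ w₂ : ℝ} (h1 : 0 < w₁) (h2 : w₂ < 0)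
    (h : ∀ i j, ρ.quad (w₁ + w₂) (w₁ * w₂) i j = 0) : ρ.HasTwoWeights w₁ w₂ := by
  have hrel := (ρ.B_quad_eq_zero_iff _ _).2 h
  have hx : ∀ x, ρ.B (ρ.B x) - (w₁ + w₂) • ρ.B x + (w₁ * w₂) • x = 0 := fun x =>
    LinearMap.congr_fun hrel x
  obtain ⟨v, hv⟩ := exists_ne (0 : V)
  set y : Rn n ⊗[ℝ] V := e ⟨0, hn⟩ ⊗ₜ v with hy
  have hyB : inner ℝ (ρ.B y) y = (0 : ℝ) := ρ.inner_B_tmul_self _ _ _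
  have hy0 : y ≠ 0 := by
    rw [← norm_ne_zero_iff, hy, TensorProduct.norm_tmul]
    simp [hv]
  have hne : ∀ μ : ℝ, μ ≠ 0 → ρ.B y - μ • y ≠ 0 := by
    intro μ hμ h0
    have h6 : inner ℝ (μ • y) y = μ * inner ℝ y y := real_inner_smul_left y y μ
    rw [sub_eq_zero.1 h0, h6] at hyB
    rcases mul_eq_zero.1 hyB with h | h
    · exact hμ h
    · exact hy0 (inner_self_eq_zero.1 h)
  refine ⟨h2.trans h1, fun μ => ⟨fun hμ => ?_, ?_⟩⟩
  · obtain ⟨x, hxμ⟩ := hμ.exists_hasEigenvector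
    have h3 := hx x
    rw [hxμ.apply_eq_smul, map_smul, hxμ.apply_eq_smul] at h3
    have h4 : ((μ - w₁) * (μ - w₂)) • x = 0 := by
      rw [← h3]
      module
    rcases mul_eq_zero.1 ((smul_eq_zero.1 h4).resolve_right hxμ.2) with h | h
    · exact Or.inl (sub_eq_zero.1 h)
    · exact Or.inr (sub_eq_zero.1 h)
  · rintro (rfl | rfl)
    · refine Module.End.hasEigenvalue_of_hasEigenvector (x := ρ.B y - w₂ • y)
        ⟨Module.End.mem_eigenspace_iff.2 ?_, hne _ h2.ne⟩
      rw [map_sub, map_smul, ← sub_eq_zero, ← hx y]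
      module
    · refine Module.End.hasEigenvalue_of_hasEigenvector (x := ρ.B y - w₁ • y)
        ⟨Module.End.mem_eigenspace_iff.2 ?_, hne _ h1.ne'⟩
      rw [map_sub, map_smul, ← sub_eq_zero, ← hx y]
      module

theorem pos_of_weight {lam : Fin (n / 2) → ℝ} {k : ℝ}
    (hk : IsHalfSpinPowerWeight n lam k ∨ IsSpinWeight n lam k) : 0 < k := by
  rcases hk with ⟨-, h, -⟩ | ⟨-, h, -⟩
  · exact h
  · rw [h]
    norm_num

omit [FiniteDimensional ℝ V] in
theorem IsIrreducible.hasTwoWeights_of_weight (hn : 2 ≤ n) (hρ : ρ.IsIrreducible)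
    {lam : Fin (n / 2) → ℝ} (hlam : ρ.IsHighestWeight lam) {k : ℝ}
    (hk : IsHalfSpinPowerWeight n lam k ∨ IsSpinWeight n lam k) :
    ρ.HasTwoWeights k (1 - n / 2 - k) := by
  have := hρ.nontrivial
  have hk0 := pos_of_weight hk
  have hn' : (2 : ℝ) ≤ n := by exact_mod_cast hn
  refine hasTwoWeights_of_quad (by omega) hk0 (by linarith) fun i j => ?_
  have := hρ.quad_eq_zero_of_weight hlam hk i j
  convert this using 2 <;> ring

theorem IsIrreducible.numWeights_eq_two_iff (hn : 2 ≤ n) (hρ : ρ.IsIrreducible)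
    {lam : Fin (n / 2) → ℝ} (hlam : ρ.IsHighestWeight lam) :
    ρ.numWeights = 2 ↔ ∃ k, IsHalfSpinPowerWeight n lam k ∨ IsSpinWeight n lam k := by
  constructor
  · intro h
    have := hρ.nontrivial
    have h2 := ρ.exists_hasTwoWeights h
    have hp := ρ.prod_neg_of_quad (by omega) h2.B_ne_zero h2.quad_eq_zero
    -- The product `w₁ w₂` is negative and `w₂ < w₁`.
    have hw : 0 < ρ.w 1 := by
      by_contra hc
      push Not at hc
      nlinarith [h2.lt]
    obtain ⟨v, hv⟩ := hlam.exists_vector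
    exact ⟨_, hv.weight_of_quad (ρ.sum_eq_of_quad h2.B_ne_zero h2.quad_eq_zero) hw
      h2.quad_eq_zero⟩
  · rintro ⟨k, hk⟩
    exact (hρ.hasTwoWeights_of_weight hn hlam hk).numWeights_eq

/-! ### The projections -/

theorem HasTwoWeights.sub_mem_eigenspace_fst {w₁ w₂ : ℝ} (h : ρ.HasTwoWeights w₁ w₂)
    (x : Rn n ⊗[ℝ] V) : ρ.B x - w₂ • x ∈ Module.End.eigenspace ρ.B w₁ := by
  have hx : ρ.B (ρ.B x) - (w₁ + w₂) • ρ.B x + (w₁ * w₂) • x = 0 :=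
    LinearMap.congr_fun h.relation x
  rw [Module.End.mem_eigenspace_iff, map_sub, map_smul, ← sub_eq_zero, ← hx]
  module

theorem HasTwoWeights.sub_mem_eigenspace_snd {w₁ w₂ : ℝ} (h : ρ.HasTwoWeights w₁ w₂)
    (x : Rn n ⊗[ℝ] V) : ρ.B x - w₁ • x ∈ Module.End.eigenspace ρ.B w₂ := by
  have hx : ρ.B (ρ.B x) - (w₁ + w₂) • ρ.B x + (w₁ * w₂) • x = 0 :=
    LinearMap.congr_fun h.relation x
  rw [Module.End.mem_eigenspace_iff, map_sub, map_smul, ← sub_eq_zero, ← hx]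
  module

variable (ρ) in
-- This is Lagrange interpolation at the two eigenvalues; the remainder lies in the other
-- eigenspace, which is orthogonal.
theorem starProjection_eigenspace_eq {μ ν : ℝ} (hμν : μ ≠ ν)
    (h1 : ∀ x, ρ.B x - ν • x ∈ Module.End.eigenspace ρ.B μ)
    (h2 : ∀ x, ρ.B x - μ • x ∈ Module.End.eigenspace ρ.B ν) (x : Rn n ⊗[ℝ] V) :
    (Module.End.eigenspace ρ.B μ).starProjection x = (μ - ν)⁻¹ • (ρ.B x - ν • x) := by
  refine Submodule.eq_starProjection_of_mem_of_inner_eq_zero (u := x)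
    (v := (μ - ν)⁻¹ • (ρ.B x - ν • x)) (Submodule.smul_mem _ _ (h1 x)) fun y hy => ?_
  have h3 : x - (μ - ν)⁻¹ • (ρ.B x - ν • x) = (ν - μ)⁻¹ • (ρ.B x - μ • x) := by
    have h4 : (μ - ν) ≠ 0 := sub_ne_zero.2 hμν
    have h5 : (ν - μ)⁻¹ = -(μ - ν)⁻¹ := by rw [← neg_sub μ ν, inv_neg]
    rw [h5]
    have h6 : (μ - ν)⁻¹ * (μ - ν) = 1 := inv_mul_cancel₀ h4
    linear_combination (norm := module) -(h6 • x)
  have h7 := real_inner_smul_left (ρ.B x - μ • x) y (ν - μ)⁻¹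
  rw [h3]
  refine h7.trans ?_
  have := ρ.B_isSymmetric.orthogonalFamily_eigenspaces hμν.symm ⟨_, h2 x⟩ ⟨y, hy⟩
  rw [show inner ℝ (ρ.B x - μ • x) y = (0 : ℝ) from this, mul_zero]

theorem HasTwoWeights.starProjection_fst {w₁ w₂ : ℝ} (h : ρ.HasTwoWeights w₁ w₂)
    (x : Rn n ⊗[ℝ] V) :
    (Module.End.eigenspace ρ.B w₁).starProjection x = (w₁ - w₂)⁻¹ • (ρ.B x - w₂ • x) :=
  ρ.starProjection_eigenspace_eq h.lt.ne' h.sub_mem_eigenspace_fst h.sub_mem_eigenspace_snd x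

theorem HasTwoWeights.starProjection_snd {w₁ w₂ : ℝ} (h : ρ.HasTwoWeights w₁ w₂)
    (x : Rn n ⊗[ℝ] V) :
    (Module.End.eigenspace ρ.B w₂).starProjection x = (w₂ - w₁)⁻¹ • (ρ.B x - w₁ • x) :=
  ρ.starProjection_eigenspace_eq h.lt.ne h.sub_mem_eigenspace_snd h.sub_mem_eigenspace_fst x

end OrthRep

end Kato

namespace Kato

/-! ### The pointwise inequality -/

section Pointwise

variable {n : ℕ} {V : Type*} [NormedAddCommGroup V] [InnerProductSpace ℝ V]
  [FiniteDimensional ℝ V]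

/-- By `hK`, the map `α ↦ Π(α ⊗ v)` multiplies lengths by `√c ‖v‖`. The element of its image closest
to `Φ` is `Π(r d ⊗ v)`, and the defect in the inequality is exactly `c` times the squared distance
to it; equality therefore means that `Φ` lies in the image. -/
theorem pointwise_kato (K : Submodule ℝ (Rn n ⊗[ℝ] V)) {v : V} (hv : v ≠ 0) {c : ℝ} (hc : 0 < c)
    (hK : ∀ α β : Rn n,
      inner ℝ (K.starProjection (α ⊗ₜ[ℝ] v)) (β ⊗ₜ[ℝ] v) = c * inner ℝ α β * ‖v‖ ^ 2)
    {Φ : Rn n ⊗[ℝ] V} (hΦ : K.starProjection Φ = Φ) {d : Rn n}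
    (hd : ∀ α : Rn n, inner ℝ Φ (α ⊗ₜ[ℝ] v) = ‖v‖ * inner ℝ d α) :
    ‖d‖ ≤ √c * ‖Φ‖ ∧
      (‖d‖ = √c * ‖Φ‖ ↔ ∃ α : Rn n, Φ = K.starProjection (α ⊗ₜ[ℝ] v)) := by
  have hv' : 0 < ‖v‖ := norm_pos_iff.2 hv
  have hproj : ∀ x y, inner ℝ (K.starProjection x) (K.starProjection y) =
      inner ℝ (K.starProjection x) y := by
    intro x y
    rw [← Submodule.inner_starProjection_left_eq_right, K.starProjection_eq_self_iff.2
      (K.starProjection_apply_mem x)]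
  have h1 : inner ℝ Φ (K.starProjection (d ⊗ₜ[ℝ] v)) = ‖v‖ * ‖d‖ ^ 2 := by
    rw [← hΦ, hproj, hΦ, hd, real_inner_self_eq_norm_sq]
  have h2 : ∀ α : Rn n, ‖K.starProjection (α ⊗ₜ[ℝ] v)‖ ^ 2 = c * ‖α‖ ^ 2 * ‖v‖ ^ 2 := by
    intro α
    rw [← real_inner_self_eq_norm_sq, hproj, hK, real_inner_self_eq_norm_sq]
  -- This `r` minimizes `‖Φ - Π(r d ⊗ v)‖`.
  set r : ℝ := (c * ‖v‖)⁻¹ with hr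
  have hrc : r * (c * ‖v‖) = 1 := inv_mul_cancel₀ (by positivity)
  have h3 : c * ‖Φ - K.starProjection ((r • d) ⊗ₜ[ℝ] v)‖ ^ 2 = c * ‖Φ‖ ^ 2 - ‖d‖ ^ 2 := by
    have h4 : inner ℝ Φ (K.starProjection ((r • d) ⊗ₜ[ℝ] v)) = r * (‖v‖ * ‖d‖ ^ 2) := by
      rw [← hΦ, hproj, hΦ, hd, inner_smul_right, real_inner_self_eq_norm_sq]
      ring
    rw [norm_sub_sq_real, h4, h2, norm_smul, Real.norm_eq_abs, mul_pow, sq_abs]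
    linear_combination (‖d‖ ^ 2 * (r * (c * ‖v‖)) + ‖d‖ ^ 2 - 2 * ‖d‖ ^ 2) * hrc
  have h5 : (√c * ‖Φ‖) ^ 2 = c * ‖Φ‖ ^ 2 := by rw [mul_pow, Real.sq_sqrt hc.le]
  have h6 : 0 ≤ √c * ‖Φ‖ := by positivity
  constructor
  · refine abs_le_of_sq_le_sq' ?_ h6 |>.2
    rw [h5]
    have : 0 ≤ c * ‖Φ - K.starProjection ((r • d) ⊗ₜ[ℝ] v)‖ ^ 2 := by positivity
    linarith
  · constructor
    · intro h
      refine ⟨r • d, ?_⟩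
      rw [← sub_eq_zero, ← norm_eq_zero, ← pow_eq_zero_iff two_ne_zero]
      have : c * ‖Φ - K.starProjection ((r • d) ⊗ₜ[ℝ] v)‖ ^ 2 = 0 := by
        rw [h3, ← h5, h, sub_self]
      exact (mul_eq_zero.1 this).resolve_left hc.ne'
    · rintro ⟨α, hα⟩
      have h7 : d = (c * ‖v‖) • α := by
        refine ext_inner_right ℝ fun β => ?_
        have h8 := hd β
        rw [hα, hK] at h8
        have h9 : ‖v‖ * (inner ℝ d β - inner ℝ ((c * ‖v‖) • α) β) = 0 := by
          rw [mul_sub, ← h8, real_inner_smul_left]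
          ring
        exact sub_eq_zero.1 ((mul_eq_zero.1 h9).resolve_left hv'.ne')
      rw [← sq_eq_sq₀ (norm_nonneg _) h6, h5, h7, hα, h2, norm_smul, Real.norm_eq_abs, mul_pow,
        sq_abs]
      ring

end Pointwise

namespace OrthRep

variable {n : ℕ} {V : Type*} [NormedAddCommGroup V] [InnerProductSpace ℝ V]
  [FiniteDimensional ℝ V] {ρ : OrthRep n V}

/-- In `Π₁ = (B - w₂) / (w₁ - w₂)` the term with `B` drops out by `inner_B_tmul_self`. -/
theorem HasTwoWeights.inner_starProjection_fst {w₁ w₂ : ℝ} (h : ρ.HasTwoWeights w₁ w₂)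
    (v : V) (α β : Rn n) :
    inner ℝ ((Module.End.eigenspace ρ.B w₁).starProjection (α ⊗ₜ[ℝ] v)) (β ⊗ₜ[ℝ] v) =
      -w₂ / (w₁ - w₂) * inner ℝ α β * ‖v‖ ^ 2 := by
  have h1 := real_inner_smul_left (ρ.B (α ⊗ₜ[ℝ] v) - w₂ • (α ⊗ₜ[ℝ] v)) (β ⊗ₜ[ℝ] v) (w₁ - w₂)⁻¹
  have h2 := real_inner_smul_left (α ⊗ₜ[ℝ] v) (β ⊗ₜ[ℝ] v) w₂
  rw [h.starProjection_fst]
  refine h1.trans ?_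
  rw [inner_sub_left, inner_B_tmul_self, h2, TensorProduct.inner_tmul, real_inner_self_eq_norm_sq]
  ring

theorem HasTwoWeights.inner_starProjection_snd {w₁ w₂ : ℝ} (h : ρ.HasTwoWeights w₁ w₂)
    (v : V) (α β : Rn n) :
    inner ℝ ((Module.End.eigenspace ρ.B w₂).starProjection (α ⊗ₜ[ℝ] v)) (β ⊗ₜ[ℝ] v) =
      w₁ / (w₁ - w₂) * inner ℝ α β * ‖v‖ ^ 2 := by
  have h1 := real_inner_smul_left (ρ.B (α ⊗ₜ[ℝ] v) - w₁ • (α ⊗ₜ[ℝ] v)) (β ⊗ₜ[ℝ] v) (w₂ - w₁)⁻¹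
  have h2 := real_inner_smul_left (α ⊗ₜ[ℝ] v) (β ⊗ₜ[ℝ] v) w₁
  have h3 : (w₂ - w₁)⁻¹ = -(w₁ - w₂)⁻¹ := by rw [← neg_sub w₁ w₂, inv_neg]
  rw [h.starProjection_snd]
  refine h1.trans ?_
  rw [inner_sub_left, inner_B_tmul_self, h2, TensorProduct.inner_tmul, real_inner_self_eq_norm_sq,
    h3]
  ring

theorem HasTwoWeights.starProjection_add {w₁ w₂ : ℝ} (h : ρ.HasTwoWeights w₁ w₂)
    (x : Rn n ⊗[ℝ] V) :
    (Module.End.eigenspace ρ.B w₁).starProjection x +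
      (Module.End.eigenspace ρ.B w₂).starProjection x = x := by
  have h3 : (w₂ - w₁)⁻¹ = -(w₁ - w₂)⁻¹ := by rw [← neg_sub w₁ w₂, inv_neg]
  have h4 : (w₁ - w₂)⁻¹ * (w₁ - w₂) = 1 := inv_mul_cancel₀ (sub_ne_zero.2 h.lt.ne')
  rw [h.starProjection_fst, h.starProjection_snd, h3]
  linear_combination (norm := module) h4 • x

end OrthRep

/-! ### The inequality on a bundle -/

section Bundle

variable {n : ℕ} {V : Type*} [NormedAddCommGroup V] [InnerProductSpace ℝ V]
  [FiniteDimensional ℝ V]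
  {M : Type*} [TopologicalSpace M] [ChartedSpace (Rn n) M] [IsManifold (𝓡 n) ∞ M]
  [RiemannianBundle (fun x : M => TangentSpace (𝓡 n) x)]
  {E : M → Type*} [TopologicalSpace (TotalSpace V E)]
  [∀ x, NormedAddCommGroup (E x)] [∀ x, InnerProductSpace ℝ (E x)]
  [FiberBundle V E]

omit [IsManifold (𝓡 n) ∞ M] [RiemannianBundle (fun x : M => TangentSpace (𝓡 n) x)] in
theorem finiteDimensional_tangentSpace (x : M) : FiniteDimensional ℝ (TangentSpace (𝓡 n) x) :=
  inferInstanceAs (FiniteDimensional ℝ (Rn n))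

namespace AssociatedBundle

variable {ρ : OrthRep n V} (S : AssociatedBundle M E ρ)

theorem inner_tmul_eq (x : M) (Φ : Rn n ⊗[ℝ] V) (α : Rn n) (v : V) :
    inner ℝ Φ (α ⊗ₜ[ℝ] v) = inner ℝ (S.fibreEquiv x Φ (S.frame x x α)) (S.triv x x v) := by
  induction Φ with
  | zero => simp
  | add Φ Ψ h h' =>
    rw [inner_add_left, h, h', map_add, add_apply, inner_add_left]
  | tmul β w =>
    rw [fibreEquiv_tmul, TensorProduct.inner_tmul, LinearIsometryEquiv.symm_apply_apply,
      real_inner_smul_left, LinearIsometryEquiv.inner_map_map]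

/-- By Parseval in the frame, the identification with `ℝⁿ ⊗ V` is isometric for the Hilbert–Schmidt
norm, whatever orthonormal basis computes it. -/
theorem sum_inner_fibreEquiv {ι : Type*} [Fintype ι] (x : M)
    (b : OrthonormalBasis ι ℝ (TangentSpace (𝓡 n) x)) (Φ Ψ : Rn n ⊗[ℝ] V) :
    ∑ i, inner ℝ (S.fibreEquiv x Φ (b i)) (S.fibreEquiv x Ψ (b i)) = inner ℝ Φ Ψ := by
  induction Φ with
  | zero => simp
  | add Φ Φ' h h' =>
    simp only [map_add, add_apply, inner_add_left, Finset.sum_add_distrib, h, h']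
  | tmul β w =>
    induction Ψ with
    | zero => simp
    | add Ψ Ψ' h h' =>
      simp only [map_add, add_apply, inner_add_right, Finset.sum_add_distrib, h,
        h']
    | tmul γ z =>
      simp only [fibreEquiv_tmul, TensorProduct.inner_tmul, real_inner_smul_left,
        real_inner_smul_right, LinearIsometryEquiv.inner_map_map]
      have := (b.map (S.frame x x).symm).sum_inner_mul_inner β γ
      simp only [OrthonormalBasis.map_apply] at this
      rw [← this, Finset.sum_mul]
      refine Finset.sum_congr rfl fun i _ => ?_
      rw [real_inner_comm γ]
      ring

theorem tensorNorm_fibreEquiv (x : M) (Φ : Rn n ⊗[ℝ] V) :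
    tensorNorm (S.fibreEquiv x Φ) = ‖Φ‖ := by
  have := finiteDimensional_tangentSpace (n := n) x
  rw [tensorNorm]
  simp only [← real_inner_self_eq_norm_sq]
  rw [S.sum_inner_fibreEquiv x (stdOrthonormalBasis ℝ (TangentSpace (𝓡 n) x))]
  exact (norm_eq_sqrt_real_inner Φ).symm

theorem exists_dual (x : M) (a : TangentSpace (𝓡 n) x →L[ℝ] ℝ) :
    ∃ α : Rn n, ‖α‖ = ‖a‖ ∧ ∀ β, inner ℝ α β = a (S.frame x x β) := by
  have := finiteDimensional_tangentSpace (n := n) x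
  have := FiniteDimensional.complete ℝ (TangentSpace (𝓡 n) x)
  refine ⟨(S.frame x x).symm ((InnerProductSpace.toDual ℝ _).symm a), ?_, fun β => ?_⟩
  · rw [LinearIsometryEquiv.norm_map, LinearIsometryEquiv.norm_map]
  · rw [← LinearIsometryEquiv.inner_map_map (S.frame x x), LinearIsometryEquiv.apply_symm_apply,
      InnerProductSpace.toDual_symm_apply]

theorem fibreEquiv_tmul_eq_smulRight (x : M) {α : Rn n} {a : TangentSpace (𝓡 n) x →L[ℝ] ℝ}
    (h : ∀ β, inner ℝ α β = a (S.frame x x β)) (v : V) :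
    S.fibreEquiv x (α ⊗ₜ v) = a.smulRight (S.triv x x v) := by
  ext X
  rw [fibreEquiv_tmul, h, LinearIsometryEquiv.apply_symm_apply]
  rfl

theorem exists_eq_proj_iff (j : ℕ) (x : M) (Φ : Rn n ⊗[ℝ] V) (v : V) :
    (∃ a : TangentSpace (𝓡 n) x →L[ℝ] ℝ,
        S.fibreEquiv x Φ = S.proj j x (a.smulRight (S.triv x x v))) ↔
      ∃ α : Rn n, Φ = ρ.proj j (α ⊗ₜ v) := by
  constructor
  · rintro ⟨a, ha⟩
    obtain ⟨α, -, hα⟩ := S.exists_dual x a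
    refine ⟨α, ?_⟩
    rw [← S.fibreEquiv_tmul_eq_smulRight x hα, proj, LinearEquiv.symm_apply_apply] at ha
    exact (S.fibreEquiv x).injective ha
  · rintro ⟨α, hα⟩
    refine ⟨(innerSL ℝ α).comp (S.frame x x).symm.toContinuousLinearEquiv.toContinuousLinearMap, ?_⟩
    rw [← S.fibreEquiv_tmul_eq_smulRight x (α := α) (fun β => by simp), proj,
      LinearEquiv.symm_apply_apply, ← hα]

/-- The refined Kato inequality at a point, for a derivative in the range of `Π_j`. -/
theorem kato_at (j : ℕ) (x : M) {c : ℝ} (hc : 0 < c)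
    (hK : ∀ (v : V) (α β : Rn n),
      inner ℝ (ρ.proj j (α ⊗ₜ[ℝ] v)) (β ⊗ₜ[ℝ] v) = c * inner ℝ α β * ‖v‖ ^ 2)
    {L : TangentSpace (𝓡 n) x →L[ℝ] E x} (hL : S.proj j x L = L) {u : E x} (hu : u ≠ 0)
    {D : TangentSpace (𝓡 n) x →L[ℝ] ℝ} (hD : ∀ X, ‖u‖ * D X = inner ℝ (L X) u) :
    ‖D‖ ≤ √c * tensorNorm L ∧
      (‖D‖ = √c * tensorNorm L ↔
        ∃ a : TangentSpace (𝓡 n) x →L[ℝ] ℝ, L = S.proj j x (a.smulRight u)) := by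
  obtain ⟨Φ, rfl⟩ := (S.fibreEquiv x).surjective L
  obtain ⟨v, rfl⟩ := (S.triv x x).surjective u
  have hv : v ≠ 0 := fun h => hu (by rw [h, map_zero])
  obtain ⟨d, hdn, hd⟩ := S.exists_dual x D
  rw [S.tensorNorm_fibreEquiv, S.exists_eq_proj_iff, ← hdn]
  refine pointwise_kato _ hv hc (hK v) ?_ fun α => ?_
  · rw [proj, LinearEquiv.symm_apply_apply] at hL
    exact (S.fibreEquiv x).injective hL
  · rw [S.inner_tmul_eq x, ← hD, hd, LinearIsometryEquiv.norm_map]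

theorem proj_snd_eq_self (h : ρ.HasTwoWeights (ρ.w 1) (ρ.w 2)) (x : M)
    {L : TangentSpace (𝓡 n) x →L[ℝ] E x} (hL : S.proj 1 x L = 0) : S.proj 2 x L = L := by
  obtain ⟨Φ, rfl⟩ := (S.fibreEquiv x).surjective L
  rw [proj, LinearEquiv.symm_apply_apply] at hL ⊢
  have h1 : ρ.proj 1 Φ = 0 := (S.fibreEquiv x).injective (by rw [hL, map_zero])
  have h2 : ρ.proj 1 Φ + ρ.proj 2 Φ = Φ := h.starProjection_add Φ
  rw [h1, zero_add] at h2
  rw [h2]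

theorem proj_fst_eq_self (h : ρ.HasTwoWeights (ρ.w 1) (ρ.w 2)) (x : M)
    {L : TangentSpace (𝓡 n) x →L[ℝ] E x} (hL : S.proj 2 x L = 0) : S.proj 1 x L = L := by
  obtain ⟨Φ, rfl⟩ := (S.fibreEquiv x).surjective L
  rw [proj, LinearEquiv.symm_apply_apply] at hL ⊢
  have h1 : ρ.proj 2 Φ = 0 := (S.fibreEquiv x).injective (by rw [hL, map_zero])
  have h2 : ρ.proj 1 Φ + ρ.proj 2 Φ = Φ := h.starProjection_add Φ
  rw [h1, add_zero] at h2
  rw [h2]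

end AssociatedBundle

omit [IsManifold (𝓡 n) ∞ M] [RiemannianBundle (fun x : M => TangentSpace (𝓡 n) x)] in
-- Both sides are half the derivative of `|ξ|²`, by the product rule and by metric compatibility; `ξ
-- x ≠ 0` makes `|ξ|` differentiable at `x`.
theorem norm_mul_mvfderiv_norm [VectorBundle ℝ V E] [ContMDiffVectorBundle ∞ V E (𝓡 n)]
    [IsContMDiffRiemannianBundle (𝓡 n) ∞ V E]
    {cov : CovariantDerivative (𝓡 n) V E} (hcov : cov.IsMetricCompatible) {ξ : (x : M) → E x}
    {x : M} (hξ : MDifferentiableAt (𝓡 n) ((𝓡 n).prod 𝓘(ℝ, V))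
      (fun x => (⟨x, ξ x⟩ : TotalSpace V E)) x) (hx : ξ x ≠ 0) (X : TangentSpace (𝓡 n) x) :
    ‖ξ x‖ * mvfderiv (𝓡 n) (fun y => ‖ξ y‖) x X = inner ℝ (cov ξ x X) (ξ x) := by
  have h1 := hcov.mvfderiv_inner_eq (fun _ => (X : Rn n)) hξ hξ
  have h2 : MDifferentiableAt (𝓡 n) 𝓘(ℝ) (fun y => ‖ξ y‖) x := by
    have h3 : (fun y => ‖ξ y‖) = Real.sqrt ∘ fun y => inner ℝ (ξ y) (ξ y) := by
      ext y
      exact norm_eq_sqrt_real_inner _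
    rw [h3]
    refine MDifferentiableAt.comp x (DifferentiableAt.mdifferentiableAt ?_) (hξ.inner_bundle hξ)
    refine (Real.hasDerivAt_sqrt ?_).differentiableAt
    exact inner_self_ne_zero.2 hx
  have h4 := mvfderiv_mul h2 h2
  have h5 : ((fun y => ‖ξ y‖) * fun y => ‖ξ y‖) = fun y => inner ℝ (ξ y) (ξ y) := by
    ext y
    exact (real_inner_self_eq_norm_mul_norm _).symm
  rw [h5] at h4
  have h6 : mvfderiv (𝓡 n) (fun y => inner ℝ (ξ y) (ξ y)) x X =
      ‖ξ x‖ * mvfderiv (𝓡 n) (fun y => ‖ξ y‖) x X +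
        ‖ξ x‖ * mvfderiv (𝓡 n) (fun y => ‖ξ y‖) x X := by
    rw [h4]
    rfl
  have h7 : mvfderiv (𝓡 n) (fun y => inner ℝ (ξ y) (ξ y)) x X =
      inner ℝ (cov ξ x X) (ξ x) + inner ℝ (ξ x) (cov ξ x X) := h1
  rw [real_inner_comm (cov ξ x X) (ξ x)] at h7
  linarith

end Bundle

end Kato

/-! ### The classification and the refined Kato inequalities -/

theorem mainTheorem3 {n : ℕ} (hn : 2 ≤ n)
    {V : Type*} [NormedAddCommGroup V] [InnerProductSpace ℝ V] [FiniteDimensional ℝ V]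
    (ρ : Kato.OrthRep n V) (hρ : ρ.IsIrreducible)
    (lam : Fin (n / 2) → ℝ) (hlam : ρ.IsHighestWeight lam)
    {M : Type*} [TopologicalSpace M] [ChartedSpace (Kato.Rn n) M] [IsManifold (𝓡 n) ∞ M]
    [RiemannianBundle (fun x : M => TangentSpace (𝓡 n) x)]
    [IsContMDiffRiemannianBundle (𝓡 n) ∞ (Kato.Rn n) (fun x : M => TangentSpace (𝓡 n) x)]
    {E : M → Type*} [TopologicalSpace (TotalSpace V E)]
    [∀ x, NormedAddCommGroup (E x)] [∀ x, InnerProductSpace ℝ (E x)]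
    [FiberBundle V E] [VectorBundle ℝ V E] [ContMDiffVectorBundle ∞ V E (𝓡 n)]
    [IsContMDiffRiemannianBundle (𝓡 n) ∞ V E]
    (S : Kato.AssociatedBundle M E ρ)
    (cov : CovariantDerivative (𝓡 n) V E) (hcov : cov.IsMetricCompatible) :
    (ρ.numWeights = 2 ↔
      ∃ k, Kato.IsHalfSpinPowerWeight n lam k ∨ Kato.IsSpinWeight n lam k) ∧
    (ρ.numWeights = 2 →
      ∀ k, Kato.IsHalfSpinPowerWeight n lam k ∨ Kato.IsSpinWeight n lam k →
        (ρ.w 1 = k ∧ ρ.w 2 = 1 - n / 2 - k) ∧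
        (√(ρ.w 1 / (ρ.w 1 - ρ.w 2)) = √(k / (2 * k + n / 2 - 1)) ∧
          ∀ ξ : (x : M) → E x, MDifferentiable (𝓡 n) ((𝓡 n).prod 𝓘(ℝ, V))
              (fun x => (⟨x, ξ x⟩ : TotalSpace V E)) → (∀ x, S.genGrad cov 1 ξ x = 0) →
            ∀ x, ξ x ≠ 0 →
              ‖mvfderiv (𝓡 n) (fun y => ‖ξ y‖) x‖ ≤
                √(ρ.w 1 / (ρ.w 1 - ρ.w 2)) * Kato.tensorNorm (cov ξ x) ∧
              (‖mvfderiv (𝓡 n) (fun y => ‖ξ y‖) x‖ =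
                  √(ρ.w 1 / (ρ.w 1 - ρ.w 2)) * Kato.tensorNorm (cov ξ x) ↔
                ∃ α : TangentSpace (𝓡 n) x →L[ℝ] ℝ,
                  cov ξ x = S.proj 2 x (α.smulRight (ξ x)))) ∧
        (√(-ρ.w 2 / (ρ.w 1 - ρ.w 2)) = √((k + n / 2 - 1) / (2 * k + n / 2 - 1)) ∧
          ∀ ξ : (x : M) → E x, MDifferentiable (𝓡 n) ((𝓡 n).prod 𝓘(ℝ, V))
              (fun x => (⟨x, ξ x⟩ : TotalSpace V E)) → (∀ x, S.genGrad cov 2 ξ x = 0) →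
            ∀ x, ξ x ≠ 0 →
              ‖mvfderiv (𝓡 n) (fun y => ‖ξ y‖) x‖ ≤
                √(-ρ.w 2 / (ρ.w 1 - ρ.w 2)) * Kato.tensorNorm (cov ξ x) ∧
              (‖mvfderiv (𝓡 n) (fun y => ‖ξ y‖) x‖ =
                  √(-ρ.w 2 / (ρ.w 1 - ρ.w 2)) * Kato.tensorNorm (cov ξ x) ↔
                ∃ α : TangentSpace (𝓡 n) x →L[ℝ] ℝ,
                  cov ξ x = S.proj 1 x (α.smulRight (ξ x))))) := by
  refine ⟨hρ.numWeights_eq_two_iff hn hlam, fun hN k hk => ?_⟩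
  have h2 := ρ.exists_hasTwoWeights hN
  -- The sorted weights and the pair computed from `lam` are both the decreasing list of eigenvalues
  -- of `B`.
  obtain ⟨hw1, hw2⟩ := h2.unique (hρ.hasTwoWeights_of_weight hn hlam hk)
  have hk0 : 0 < k := Kato.OrthRep.pos_of_weight hk
  have hn' : (2 : ℝ) ≤ n := by exact_mod_cast hn
  have hD : 0 < ρ.w 1 - ρ.w 2 := sub_pos.2 h2.lt
  refine ⟨⟨hw1, hw2⟩, ⟨?_, fun ξ hξ hP x hx => ?_⟩, ⟨?_, fun ξ hξ hP x hx => ?_⟩⟩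
  · rw [hw1, hw2]
    congr 2
    ring
  -- `P₁ ξ = 0` puts `∇ξ` in the range of `Π₂`, whose constant `w₁ / (w₁ - w₂)` is the one that
  -- enters.
  · exact S.kato_at 2 x (div_pos (hw1 ▸ hk0) hD) h2.inner_starProjection_snd
      (S.proj_snd_eq_self h2 x (hP x)) hx (Kato.norm_mul_mvfderiv_norm hcov (hξ x) hx)
  · rw [hw1, hw2]
    congr 2 <;> ring
  · exact S.kato_at 1 x (div_pos (by rw [hw2]; linarith) hD) h2.inner_starProjection_fst
      (S.proj_fst_eq_self h2 x (hP x)) hx (Kato.norm_mul_mvfderiv_norm hcov (hξ x) hx)
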